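/- Let $\Pi=(\mathbb R/\mathbb Z)\times\mathbb R$ be the infinite strip that is periodic in $x_1$ with period $1$, with its Lebesgue measure. For a vector field $v=(v^1,v^2)$ on $\Pi$, $\operatorname{div}v=\partial_1v^1+\partial_2v^2$ and $\operatorname{curl}v=\partial_1v^2-\partial_2v^1$ are taken in the sense of distributions on $\Pi$. Let $S(\Pi)$ be the space of vector fields $v\in L^\infty(\Pi)$ with $\operatorname{div}v=0$ and $\operatorname{curl}v\in L^\infty(\Pi)$; such fields, like all $L^\infty$ functions, are identified when they agree almost everywhere. Let $$K_\infty(x)=\frac{\bigl(-\sinh(2\pi x_2),\ \sin(2\pi x_1)\bigr)}{2\,\bigl(\cosh(2\pi x_2)-\cos(2\pi x_1)\bigr)},\qquad (K_\infty*\omega)(x)=\int_\Pi K_\infty(x-y)\,\omega(y)\,dy .$$ For a vector field $v$ on $\Pi$ and almost every $x_2\in\mathbb R$ put $$m_1[v](x_2)=\int_{-1/2}^{1/2}v^1(x_1,x_2)\,dx_1,\qquad m_2[v](x_2)=\int_{-1/2}^{1/2}v^2(x_1,x_2)\,dx_1 .$$ When $m_2[v](x_2)$ is the same number for almost every $x_2$,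 this number is written $m_2[v]$. Further, $m_1[v](\pm\infty)$ denotes the limit of $m_1[v](x_2)$ as $x_2\to\pm\infty$ outside a null set of $x_2$. Let $\omega\in L^\infty(\Pi)$ have compact support. Then the integral $(K_\infty*\omega)(x)$ converges absolutely for every $x\in\Pi$, and the following hold. (1) If $v\in S(\Pi)$ and $\operatorname{curl}v=\omega$, then the numbers $m_2[v]$, $m_1[v](-\infty)$ and $m_1[v](\infty)$ exist, and $$v=K_\infty*\omega\quad\Longleftrightarrow\quad m_2[v]=0\ \text{ and }\ m_1[v](-\infty)+m_1[v](\infty)=0 .$$ (2) $K_\infty*\omega$ is the unique $v\in S(\Pi)$ with $\operatorname{curl}v=\omega$, $m_2[v]=0$ and $m_1[v](-\infty)+m_1[v](\infty)=0$. -/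

import Mathlib

open MeasureTheory Filter Topology
open scoped ENNReal

/-- The periodic strip `S¹ × ℝ = ℝ² / (ℤ × {0})`, with the product of the arc length measure
on the circle (of total mass `1`) and Lebesgue measure. -/
abbrev Strip : Type := AddCircle (1 : ℝ) × ℝ

namespace Strip

/-- The derivative `∂₁φ` along the circle. -/
noncomputable def partialOne (φ : Strip → ℝ) (x : Strip) : ℝ :=
  deriv (fun t : ℝ => φ (x.1 + (t : AddCircle (1 : ℝ)), x.2)) 0

/-- The vertical derivative `∂₂φ`. -/
noncomputable def partialTwo (φ : Strip → ℝ) (x : Strip) : ℝ :=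
  deriv (fun t : ℝ => φ (x.1, x.2 + t)) 0

/-- Test functions on the strip: compactly supported functions that are smooth, that is, whose
lift to the covering space `ℝ²` is smooth. -/
structure IsTest (φ : Strip → ℝ) : Prop where
  smooth : ContDiff ℝ ((⊤ : ℕ∞) : WithTop ℕ∞) (fun p : ℝ × ℝ => φ ((p.1 : AddCircle (1 : ℝ)), p.2))
  compactSupport : HasCompactSupport φ

/-- `div v = 0` in the sense of distributions, for a locally integrable vector field `v`. -/
def IsDivFree (v : Strip → ℝ × ℝ) : Prop :=
  LocallyIntegrable v volume ∧
  ∀ φ : Strip → ℝ, IsTest φ →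
    ∫ x, ((v x).1 * partialOne φ x + (v x).2 * partialTwo φ x) = 0

/-- `curl v = ∂₁v² - ∂₂v¹ = ω` in the sense of distributions, for locally integrable `v`, `ω`. -/
def HasCurl (v : Strip → ℝ × ℝ) (ω : Strip → ℝ) : Prop :=
  LocallyIntegrable v volume ∧ LocallyIntegrable ω volume ∧
  ∀ φ : Strip → ℝ, IsTest φ →
    ∫ x, ω x * φ x = - ∫ x, ((v x).2 * partialOne φ x - (v x).1 * partialTwo φ x)

/-- The Serfati space `S(Π)`: essentially bounded, divergence-free vector fields with
essentially bounded vorticity. -/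
structure MemS (v : Strip → ℝ × ℝ) : Prop where
  bounded : MemLp v ∞ volume
  divFree : IsDivFree v
  boundedCurl : ∃ ω : Strip → ℝ, MemLp ω ∞ volume ∧ HasCurl v ω

/-- `ω ∈ L^∞_c(Π)`: essentially bounded, and vanishing almost everywhere off a compact set. -/
def MemLinftyC (ω : Strip → ℝ) : Prop :=
  MemLp ω ∞ volume ∧ ∃ C : Set Strip, IsCompact C ∧ ∀ᵐ x : Strip, x ∉ C → ω x = 0

/-- The kernel `K_∞` as a function on `ℝ²` that is `1`-periodic in the first variable. -/
noncomputable def kernelPlane (x₂ x₁ : ℝ) : ℝ × ℝ :=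
  (-Real.sinh (2 * Real.pi * x₂) /
      (2 * (Real.cosh (2 * Real.pi * x₂) - Real.cos (2 * Real.pi * x₁))),
    Real.sin (2 * Real.pi * x₁) /
      (2 * (Real.cosh (2 * Real.pi * x₂) - Real.cos (2 * Real.pi * x₁))))

theorem kernelPlane_periodic (x₂ : ℝ) : Function.Periodic (kernelPlane x₂) 1 := by
  intro x₁
  simp only [kernelPlane, mul_add, mul_one, Real.cos_add_two_pi, Real.sin_add_two_pi]

/-- The kernel is half of the cotangent of `π z̄`, `z = x₁ + i x₂`, rotated by 90 degrees
counterclockwise. -/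
theorem kernelPlane_eq_cot (x₁ x₂ : ℝ) :
    ((kernelPlane x₂ x₁).1 + (kernelPlane x₂ x₁).2 * Complex.I : ℂ) =
      Complex.I / 2 *
        Complex.cot (Real.pi * (starRingEnd ℂ) ((x₁ : ℂ) + x₂ * Complex.I)) := by
  have harg : (Real.pi : ℂ) * (starRingEnd ℂ) ((x₁ : ℂ) + x₂ * Complex.I) =
      ((Real.pi * x₁ : ℝ) : ℂ) + ((-(Real.pi * x₂) : ℝ) : ℂ) * Complex.I := by
    simp only [map_add, map_mul, Complex.conj_ofReal, Complex.conj_I]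
    push_cast
    ring
  have h1 : 2 * Real.pi * x₁ = 2 * (Real.pi * x₁) := by ring
  have h2 : 2 * Real.pi * x₂ = 2 * (Real.pi * x₂) := by ring
  simp only [kernelPlane]
  rw [harg, h1, h2]
  generalize Real.pi * x₁ = a
  generalize Real.pi * x₂ = b
  rw [Complex.cot, Complex.cos_add_mul_I, Complex.sin_add_mul_I]
  simp only [← Complex.ofReal_cos, ← Complex.ofReal_sin, ← Complex.ofReal_cosh,
    ← Complex.ofReal_sinh, Real.cosh_neg, Real.sinh_neg]
  rw [Real.cosh_two_mul, Real.sinh_two_mul, Real.cos_two_mul, Real.sin_two_mul]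
  have hc := Real.cosh_sq b
  have ht := Real.sin_sq_add_cos_sq a
  generalize Real.cosh b = C at *
  generalize Real.sinh b = S at *
  generalize Real.cos a = c at *
  generalize Real.sin a = s at *
  have hD : C ^ 2 + S ^ 2 - (2 * c ^ 2 - 1) = 2 * (s ^ 2 + S ^ 2) := by linarith
  have hN : s * C * (s * C) + c * S * (c * S) = s ^ 2 + S ^ 2 := by
    have : s ^ 2 = 1 - c ^ 2 := by linarith
    linear_combination s ^ 2 * hc + S ^ 2 * ht
  rw [hD]
  rcases eq_or_ne (s ^ 2 + S ^ 2) 0 with h0 | h0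
  · have hs : s = 0 := by nlinarith [sq_nonneg s, sq_nonneg S]
    have hS : S = 0 := by nlinarith [sq_nonneg s, sq_nonneg S]
    simp [hs, hS]
  · have hN0 : ((s : ℂ) ^ 2 + (S : ℂ) ^ 2) ≠ 0 := by exact_mod_cast h0
    have hden : (s : ℂ) * C + c * (-S : ℝ) * Complex.I ≠ 0 := by
      intro h
      apply h0
      have hre := congrArg Complex.re h
      have him := congrArg Complex.im h
      simp at hre him
      rcases hre with hre | hre
      · rcases him with him | him
        · rw [hre, him] at ht
          norm_num at ht
        · rw [hre, him]
          norm_num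
      · rw [hre] at hc
        nlinarith [sq_nonneg S]
    have hcC : (C : ℂ) ^ 2 = S ^ 2 + 1 := by exact_mod_cast hc
    have htC : (s : ℂ) ^ 2 + c ^ 2 = 1 := by exact_mod_cast ht
    push_cast at hden ⊢
    have hL : -(2 * (S : ℂ) * C) / (2 * (2 * (s ^ 2 + S ^ 2))) +
        2 * s * c / (2 * (2 * (s ^ 2 + S ^ 2))) * Complex.I =
        (-(S * C) + s * c * Complex.I) / (2 * (s ^ 2 + S ^ 2)) := by
      field_simp
    rw [hL, div_mul_div_comm,
      div_eq_div_iff (mul_ne_zero two_ne_zero hN0) (mul_ne_zero two_ne_zero hden)]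
    have hI : Complex.I ^ 2 = -1 := Complex.I_sq
    linear_combination (-2 * s * S * c ^ 2 - 2 * s * S * (s ^ 2 + S ^ 2)) * hI
      - 2 * s * S * hcC + 2 * s * S * htC

/-- The Biot-Savart kernel `K_∞` on the strip. -/
noncomputable def kernel (x : Strip) : ℝ × ℝ :=
  (kernelPlane_periodic x.2).lift x.1

/-- The convolution `(K_∞ * ω)(x) = ∫_Π K_∞(x - y) ω(y) dy`. -/
noncomputable def biotSavart (ω : Strip → ℝ) (x : Strip) : ℝ × ℝ :=
  ∫ y : Strip, ω y • kernel (x - y)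

/-- The mean value of `v¹` on the horizontal line at height `a`. -/
noncomputable def m1 (v : Strip → ℝ × ℝ) (a : ℝ) : ℝ :=
  ∫ s : AddCircle (1 : ℝ), (v (s, a)).1

/-- The mean value of `v²` on the horizontal line at height `a`. -/
noncomputable def m2 (v : Strip → ℝ × ℝ) (a : ℝ) : ℝ :=
  ∫ s : AddCircle (1 : ℝ), (v (s, a)).2

/-- `m₂[v] = m`: the mean value of `v²` on horizontal lines is `m`. The fields are
defined up to null sets, so this is asked on almost every line. -/
def HasM2 (v : Strip → ℝ × ℝ) (m : ℝ) : Prop :=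
  ∀ᵐ a : ℝ, m2 v a = m

/-- `m₁[v](∞) = m`, as a limit that ignores a null set of heights. -/
def HasM1Top (v : Strip → ℝ × ℝ) (m : ℝ) : Prop :=
  Tendsto (m1 v) (atTop ⊓ ae volume) (𝓝 m)

/-- `m₁[v](-∞) = m`, as a limit that ignores a null set of heights. -/
def HasM1Bot (v : Strip → ℝ × ℝ) (m : ℝ) : Prop :=
  Tendsto (m1 v) (atBot ⊓ ae volume) (𝓝 m)

end Strip

/-! Write a field as its complex velocity f = v¹ - i v². For bounded f, the conditions div v = 0 and
curl v = ω together become the single weak equation ∫ f (∂₁ + i∂₂)φ = i ∫ ω φ, that is, an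
inhomogeneous Cauchy-Riemann equation. In this form the kernel is `halfCot`, z ↦ -(i/2) cot(πz):
1-periodic, meromorphic with simple poles at the integers, and tending to -1/2 and 1/2 at the upper
and lower ends of the strip.

Existence rests on the kernel being a fundamental solution (`IsTest.integral_cker_mul_dbar`): away
from height 0 Green's theorem applies on a period rectangle, and the Dirac mass comes from the jump
of the mean of `halfCot` across height 0. Fubini carries this over to the convolution with ω, which
is bounded because the kernel is locally integrable and bounded far from height 0.

Uniqueness up to a constant is a Liouville theorem (`ae_eq_const_of_integral_mul_dbar_eq_zero`):
each Fourier coefficient in x₁ of a bounded solution of the homogeneous equation solves a linear ODE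
in x₂, whose nonzero bounded solutions occur only at frequency 0 and are constants.

Hence v = K_∞ * ω + a for a constant vector a. The convolution has m₂ = 0 by the reflection x₁ ↦
-x₁, and its m₁ tends to ∓(1/2)∫ω at ±∞. So m₂[v] = a² and m₁[v](-∞) + m₁[v](∞) = 2a¹, and the two
conditions say exactly that a = 0. -/

namespace Strip

/-! ### The kernel as a periodic meromorphic function -/

/-- The complex velocity `v¹ - i v²` of a vector `v`. -/
noncomputable def toComplex : ℝ × ℝ →L[ℝ] ℂ :=
  Complex.ofRealCLM.comp (ContinuousLinearMap.fst ℝ ℝ ℝ) -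
    Complex.I • Complex.ofRealCLM.comp (ContinuousLinearMap.snd ℝ ℝ ℝ)

theorem toComplex_apply (v : ℝ × ℝ) : toComplex v = v.1 - v.2 * Complex.I := by
  simp [toComplex, mul_comm]

@[simp] theorem toComplex_re (v : ℝ × ℝ) : (toComplex v).re = v.1 := by
  simp [toComplex_apply]

@[simp] theorem toComplex_im (v : ℝ × ℝ) : (toComplex v).im = -v.2 := by
  simp [toComplex_apply]

theorem toComplex_injective : Function.Injective toComplex := by
  intro v w h
  have h1 := congrArg Complex.re h
  have h2 := congrArg Complex.im h
  simp only [toComplex_re, toComplex_im, neg_inj] at h1 h2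
  exact Prod.ext h1 h2

/-- The function `-(i / 2) cot (π z)`, written in terms of `exp (2 π i z)`. -/
noncomputable def halfCot (z : ℂ) : ℂ :=
  (Complex.exp (2 * Real.pi * Complex.I * z) + 1) /
    (2 * (Complex.exp (2 * Real.pi * Complex.I * z) - 1))

theorem toComplex_kernelPlane (x y : ℝ) :
    toComplex (kernelPlane y x) = halfCot (x + y * Complex.I) := by
  have h := congrArg (starRingEnd ℂ) (kernelPlane_eq_cot x y)
  have h0 : (starRingEnd ℂ) ((kernelPlane y x).1 + (kernelPlane y x).2 * Complex.I) =
      toComplex (kernelPlane y x) := by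
    rw [toComplex_apply]
    simp [sub_eq_add_neg]
  rw [h0] at h
  rw [h, map_mul, ← Complex.cot_conj, map_mul, Complex.conj_conj, Complex.conj_ofReal, map_div₀,
    Complex.conj_I, Complex.cot_eq_exp_ratio, halfCot]
  have e : 2 * Complex.I * (Real.pi * (x + y * Complex.I) : ℂ) =
    2 * Real.pi * Complex.I * (x + y * Complex.I) := by ring
  rw [e]
  generalize Complex.exp (2 * Real.pi * Complex.I * (x + y * Complex.I)) = q
  -- q = 1 is the pole, where division by zero makes both sides 0.
  rcases eq_or_ne q 1 with rfl | hq
  · simp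
  · have h1 : q - 1 ≠ 0 := sub_ne_zero.2 hq
    have h2 : 1 - q ≠ 0 := sub_ne_zero.2 hq.symm
    have hc : (starRingEnd ℂ) 2 = 2 := Complex.conj_ofNat 2
    rw [hc]
    field_simp
    ring

theorem halfCot_neg (z : ℂ) : halfCot (-z) = -halfCot z := by
  unfold halfCot
  rw [mul_neg, Complex.exp_neg]
  have h0 := Complex.exp_ne_zero (2 * Real.pi * Complex.I * z)
  generalize Complex.exp (2 * Real.pi * Complex.I * z) = q at *
  rcases eq_or_ne q 1 with rfl | hq
  · simp
  · have h1 : q - 1 ≠ 0 := sub_ne_zero.2 hq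
    have h2 : 1 - q ≠ 0 := sub_ne_zero.2 hq.symm
    have h3 : q⁻¹ - 1 ≠ 0 := by
      rw [Ne, sub_eq_zero, inv_eq_one]
      exact hq
    field_simp
    ring

theorem halfCot_add_one (z : ℂ) : halfCot (z + 1) = halfCot z := by
  unfold halfCot
  rw [mul_add, mul_one, Complex.exp_add, Complex.exp_two_pi_mul_I, mul_one]

/-- With C, c the hyperbolic and circular cosines, sinh² + sin² = C² - c², so the squared norm is (C
+ c)/(4(C - c)) = 1/4 + c/(2(C - c)). The denominator is bounded below through C - c = 2(sinh²(πy) +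
sin²(πx)) ≥ 8(x² + y²), by |sinh t| ≥ |t| and Jordan's inequality, which needs |x| ≤ 1/2. -/
theorem normSq_halfCot_le {x : ℝ} (y : ℝ) (hx : |x| ≤ 1 / 2) :
    ‖halfCot (x + y * Complex.I)‖ ^ 2 ≤ 1 / 4 + 1 / (16 * (x ^ 2 + y ^ 2)) := by
  rw [← toComplex_kernelPlane, ← Complex.normSq_eq_norm_sq, Complex.normSq_apply, toComplex_re,
    toComplex_im]
  simp only [kernelPlane]
  rcases eq_or_ne (x ^ 2 + y ^ 2) 0 with h0 | h0
  · have hx0 : x = 0 := by nlinarith [sq_nonneg x, sq_nonneg y]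
    have hy0 : y = 0 := by nlinarith [sq_nonneg x, sq_nonneg y]
    simp [hx0, hy0]
  have hpos : 0 < x ^ 2 + y ^ 2 := lt_of_le_of_ne (by positivity) h0.symm
  have hC := Real.cosh_sq (2 * Real.pi * y)
  have hc := Real.sin_sq_add_cos_sq (2 * Real.pi * x)
  have hlow : 8 * (x ^ 2 + y ^ 2) ≤ Real.cosh (2 * Real.pi * y) - Real.cos (2 * Real.pi * x) := by
    have e1 : Real.cosh (2 * Real.pi * y) = 1 + 2 * Real.sinh (Real.pi * y) ^ 2 := by
      rw [mul_assoc, Real.cosh_two_mul, Real.cosh_sq]; ring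
    have e2 : Real.cos (2 * Real.pi * x) = 1 - 2 * Real.sin (Real.pi * x) ^ 2 := by
      rw [mul_assoc, Real.cos_two_mul, Real.sin_sq]; ring
    have b1 : (2 * y) ^ 2 ≤ Real.sinh (Real.pi * y) ^ 2 := by
      rw [sq_le_sq, Real.abs_sinh]
      refine le_trans ?_ (Real.self_le_sinh_iff.2 (abs_nonneg _))
      rw [abs_mul, abs_mul, abs_two, abs_of_pos Real.pi_pos]
      nlinarith [Real.pi_gt_three, abs_nonneg y]
    have b2 : (2 * x) ^ 2 ≤ Real.sin (Real.pi * x) ^ 2 := by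
      rw [sq_le_sq]
      have := Real.mul_abs_le_abs_sin (x := Real.pi * x) (by
        rw [abs_mul, abs_of_pos Real.pi_pos]; nlinarith [Real.pi_pos])
      refine le_trans (le_of_eq ?_) this
      rw [abs_mul, abs_mul, abs_two, abs_of_pos Real.pi_pos]
      field_simp
    rw [e1, e2]
    linarith
  generalize Real.cosh (2 * Real.pi * y) = C at *
  generalize Real.sinh (2 * Real.pi * y) = S at *
  generalize Real.sin (2 * Real.pi * x) = s at *
  have hc1 : Real.cos (2 * Real.pi * x) ≤ 1 := Real.cos_le_one _
  generalize Real.cos (2 * Real.pi * x) = c at *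
  have hD : 0 < C - c := by linarith
  have e : -S / (2 * (C - c)) * (-S / (2 * (C - c))) +
      -(s / (2 * (C - c))) * -(s / (2 * (C - c))) = 1 / 4 + c / (2 * (C - c)) := by
    field_simp
    have : S ^ 2 + s ^ 2 = C ^ 2 - c ^ 2 := by linarith
    linear_combination 4 * this
  rw [e]
  gcongr 1 / 4 + ?_
  calc c / (2 * (C - c)) ≤ 1 / (2 * (C - c)) := by gcongr
    _ ≤ 1 / (16 * (x ^ 2 + y ^ 2)) := by
      apply one_div_le_one_div_of_le (by positivity); linarith

theorem norm_halfCot_le {x : ℝ} (y : ℝ) (hx : |x| ≤ 1 / 2) :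
    ‖halfCot (x + y * Complex.I)‖ ≤ 1 / 2 + 1 / (4 * √(x ^ 2 + y ^ 2)) := by
  refine (sq_le_sq₀ (norm_nonneg _) (by positivity)).1 ((normSq_halfCot_le y hx).trans ?_)
  have h : √(x ^ 2 + y ^ 2) ^ 2 = x ^ 2 + y ^ 2 := Real.sq_sqrt (by positivity)
  have : (1 / (4 * √(x ^ 2 + y ^ 2))) ^ 2 = 1 / (16 * (x ^ 2 + y ^ 2)) := by
    rw [div_pow, mul_pow, h]; norm_num
  have h0 : 0 ≤ 1 / (4 * √(x ^ 2 + y ^ 2)) := by positivity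
  nlinarith

theorem exp_ne_one_of_im_ne_zero {z : ℂ} (hz : z.im ≠ 0) :
    Complex.exp (2 * Real.pi * Complex.I * z) - 1 ≠ 0 := by
  intro h
  have h1 := congrArg norm (sub_eq_zero.1 h)
  rw [Complex.norm_exp, norm_one, Real.exp_eq_one_iff] at h1
  simp at h1
  exact hz h1

theorem differentiableAt_halfCot {z : ℂ} (hz : z.im ≠ 0) : DifferentiableAt ℂ halfCot z := by
  unfold halfCot
  have := exp_ne_one_of_im_ne_zero hz
  refine DifferentiableAt.div (by fun_prop) (by fun_prop) (by simpa using this)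

theorem norm_exp_two_pi_I_mul (z : ℂ) :
    ‖Complex.exp (2 * Real.pi * Complex.I * z)‖ = Real.exp (-(2 * Real.pi * z.im)) := by
  rw [Complex.norm_exp]
  simp

/-- `halfCot` tends to `-1/2` at the upper end of the strip. -/
theorem norm_halfCot_add_half_le {z : ℂ} (hz : 0 < z.im) :
    ‖halfCot z + 1 / 2‖ ≤
      Real.exp (-(2 * Real.pi * z.im)) / (1 - Real.exp (-(2 * Real.pi * z.im))) := by
  have h1 := exp_ne_one_of_im_ne_zero hz.ne'
  have hn := norm_exp_two_pi_I_mul z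
  unfold halfCot
  generalize Complex.exp (2 * Real.pi * Complex.I * z) = q at *
  have e : (q + 1) / (2 * (q - 1)) + 1 / 2 = q / (q - 1) := by field_simp; ring
  rw [e, norm_div, hn]
  have hlt : Real.exp (-(2 * Real.pi * z.im)) < 1 := by
    rw [Real.exp_lt_one_iff]; have := Real.pi_pos; nlinarith [mul_pos Real.pi_pos hz]
  refine div_le_div_of_nonneg_left (Real.exp_pos _).le (by linarith) ?_
  rw [← hn]
  have := norm_sub_norm_le 1 q
  rw [norm_one, norm_sub_rev] at this
  exact this

/-- The substitution q = exp(2πiz) turns the integral into the average of (q + 1)/(2(q - 1)) over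
the circle of radius exp(-2πy) < 1. This function is holomorphic on the closed disc, so the average
is its value -1/2 at q = 0. -/
theorem integral_halfCot_of_pos {y : ℝ} (hy : 0 < y) :
    ∫ x in (-(1 / 2) : ℝ)..(1 / 2), halfCot (x + y * Complex.I) = -(1 / 2) := by
  set r : ℝ := Real.exp (-(2 * Real.pi * y)) with hr
  have hr0 : 0 < r := Real.exp_pos _
  have hr1 : r < 1 := by
    rw [hr, Real.exp_lt_one_iff]; nlinarith [mul_pos Real.pi_pos hy]
  have hper : Function.Periodic (fun x : ℝ => halfCot (x + y * Complex.I)) 1 := by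
    intro x
    have : ((x + 1 : ℝ) + y * Complex.I : ℂ) = x + y * Complex.I + 1 := by push_cast; ring
    simp only [this, halfCot_add_one]
  have h1 := hper.intervalIntegral_add_eq (-(1 / 2)) 0
  norm_num at h1
  norm_num
  rw [h1]
  have hd : DiffContOnCl ℂ (fun q : ℂ => (q + 1) / (2 * (q - 1))) (Metric.ball 0 |r|) := by
    apply DifferentiableOn.diffContOnCl
    intro q hq
    have hq' : ‖q‖ ≤ r := by
      have := Metric.closure_ball_subset_closedBall hq
      simpa [abs_of_pos hr0] using this
    have : q - 1 ≠ 0 := by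
      intro h
      rw [sub_eq_zero] at h
      rw [h, norm_one] at hq'
      linarith
    refine (DifferentiableAt.div (by fun_prop) (by fun_prop) (by simpa using this)).differentiableWithinAt
  have h2 := hd.circleAverage
  rw [Real.circleAverage_def] at h2
  have h3 : ∀ x : ℝ, halfCot (x + y * Complex.I) =
      (fun θ : ℝ => (circleMap 0 r θ + 1) / (2 * (circleMap 0 r θ - 1))) (2 * Real.pi * x) := by
    intro x
    have : Complex.exp (2 * Real.pi * Complex.I * (x + y * Complex.I)) =
        circleMap 0 r (2 * Real.pi * x) := by
      rw [circleMap, zero_add, hr, Complex.ofReal_exp, ← Complex.exp_add]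
      congr 1
      push_cast
      linear_combination 2 * Real.pi * y * Complex.I_sq
    simp only [halfCot, this]
  have h4 := intervalIntegral.integral_comp_mul_left (a := 0) (b := 1)
    (fun θ : ℝ => (circleMap 0 r θ + 1) / (2 * (circleMap 0 r θ - 1)))
    (mul_pos two_pos Real.pi_pos).ne'
  rw [mul_zero, mul_one, h2] at h4
  rw [intervalIntegral.integral_congr fun x _ => h3 x, h4]
  norm_num

theorem integral_halfCot_of_neg {y : ℝ} (hy : y < 0) :
    ∫ x in (-(1 / 2) : ℝ)..(1 / 2), halfCot (x + y * Complex.I) = 1 / 2 := by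
  have h := integral_halfCot_of_pos (neg_pos.2 hy)
  have e : ∀ x : ℝ, halfCot (x + y * Complex.I) = -(fun t : ℝ => halfCot (t + (-y : ℝ) * Complex.I)) (-x) := by
    intro x
    simp only
    rw [← halfCot_neg]
    congr 1
    push_cast
    ring
  have h2 := intervalIntegral.integral_comp_neg (a := -(1 / 2)) (b := 1 / 2)
    (fun t : ℝ => halfCot (t + (-y : ℝ) * Complex.I))
  rw [neg_neg] at h2
  rw [intervalIntegral.integral_congr fun x _ => e x, intervalIntegral.integral_neg, h2, h, neg_neg]

end Strip

/-! ### The covering of the strip by the plane, and local integrability of the kernel -/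

namespace Strip

/-- The covering map of the strip by the plane. -/
def proj (p : ℝ × ℝ) : Strip := ((p.1 : AddCircle (1 : ℝ)), p.2)

/-- Lebesgue measure on a fundamental domain of the covering map. -/
noncomputable def cellMeasure : Measure (ℝ × ℝ) :=
  (volume.restrict (Set.Ioc (-(1 / 2) : ℝ) (1 / 2))).prod volume

theorem measurePreserving_mk_half :
    MeasurePreserving ((↑) : ℝ → AddCircle (1 : ℝ))
      (volume.restrict (Set.Ioc (-(1 / 2) : ℝ) (1 / 2))) volume := by
  have h := AddCircle.measurePreserving_mk (1 : ℝ) (-(1 / 2))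
  norm_num at h ⊢
  exact h

theorem measurePreserving_proj : MeasurePreserving proj cellMeasure volume :=
  measurePreserving_mk_half.prod (MeasurePreserving.id volume)

theorem isOpenQuotientMap_proj : IsOpenQuotientMap proj :=
  QuotientAddGroup.isOpenQuotientMap_mk.prodMap IsOpenQuotientMap.id

theorem continuous_proj : Continuous proj := isOpenQuotientMap_proj.continuous

theorem exists_proj (x : Strip) :
    ∃ s : ℝ, s ∈ Set.Ioc (-(1 / 2) : ℝ) (1 / 2) ∧ proj (s, x.2) = x := by
  refine ⟨AddCircle.equivIoc 1 (-(1 / 2)) x.1, ?_, ?_⟩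
  · have h := (AddCircle.equivIoc (1 : ℝ) (-(1 / 2)) x.1).2
    norm_num at h ⊢
    exact h
  · exact Prod.ext AddCircle.coe_equivIoc rfl

theorem ae_cell : ∀ᵐ p ∂cellMeasure, |p.1| ≤ 1 / 2 := by
  have h : ∀ᵐ s : ℝ ∂(volume.restrict (Set.Ioc (-(1 / 2) : ℝ) (1 / 2))), |s| ≤ 1 / 2 := by
    filter_upwards [ae_restrict_mem measurableSet_Ioc] with s hs
    exact abs_le.2 ⟨hs.1.le, hs.2⟩
  exact Measure.quasiMeasurePreserving_fst.ae h

theorem ae_cell_ne_zero : ∀ᵐ p ∂cellMeasure, p.1 ≠ 0 ∧ p.2 ≠ 0 := by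
  have h : ∀ᵐ s : ℝ ∂(volume.restrict (Set.Ioc (-(1 / 2) : ℝ) (1 / 2))), s ≠ 0 :=
    ae_restrict_of_ae (Measure.ae_ne volume 0)
  filter_upwards [Measure.quasiMeasurePreserving_fst.ae h,
    Measure.quasiMeasurePreserving_snd.ae (Measure.ae_ne volume (0 : ℝ))] with p h1 h2
  exact ⟨h1, h2⟩

/-- The Biot-Savart kernel in complex form. -/
noncomputable def cker (x : Strip) : ℂ := toComplex (kernel x)

theorem cker_proj (p : ℝ × ℝ) : cker (proj p) = halfCot (p.1 + p.2 * Complex.I) := by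
  rw [← toComplex_kernelPlane]
  rfl

theorem cker_neg (x : Strip) : cker (-x) = -cker x := by
  obtain ⟨s, -, hs⟩ := exists_proj x
  have h : -x = proj (-s, -x.2) := by
    rw [← hs]
    simp [proj]
  rw [h, ← hs, cker_proj, cker_proj, ← halfCot_neg]
  congr 1
  simp [proj]
  ring

/-- This oddness in x₁ is what makes m₂ of the convolution vanish. -/
theorem kernelPlane_neg_left (x y : ℝ) : (kernelPlane y (-x)).2 = -(kernelPlane y x).2 := by
  simp [kernelPlane, neg_div]

theorem kernel_neg_left (s : AddCircle (1 : ℝ)) (y : ℝ) :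
    (kernel (-s, y)).2 = -(kernel (s, y)).2 := by
  induction s using QuotientAddGroup.induction_on with
  | H x => exact kernelPlane_neg_left x y

theorem measurable_kernel : Measurable kernel := by
  have h : kernel = fun x : Strip =>
      kernelPlane x.2 (AddCircle.measurableEquivIoc (1 : ℝ) (-(1 / 2)) x.1 : ℝ) := by
    funext x
    conv_lhs => rw [kernel, ← AddCircle.coe_equivIoc (p := (1 : ℝ)) (a := -(1 / 2)) (y := x.1)]
    rfl
  have h1 : Measurable fun x : Strip =>
      ((AddCircle.measurableEquivIoc (1 : ℝ) (-(1 / 2)) x.1 : ℝ)) :=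
    measurable_subtype_coe.comp ((MeasurableEquiv.measurable _).comp measurable_fst)
  rw [h]
  simp only [kernelPlane]
  fun_prop

theorem measurable_cker : Measurable cker := toComplex.measurable.comp measurable_kernel

theorem norm_cker_le {x : Strip} (hx : 1 ≤ |x.2|) : ‖cker x‖ ≤ 1 := by
  obtain ⟨s, hs, hsx⟩ := exists_proj x
  rw [← hsx, cker_proj]
  refine (norm_halfCot_le _ (abs_le.2 ⟨hs.1.le, hs.2⟩)).trans ?_
  have h1 : 1 ≤ √(s ^ 2 + x.2 ^ 2) := by
    rw [Real.one_le_sqrt]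
    nlinarith [sq_nonneg s, sq_abs x.2]
  have : 1 / (4 * √(s ^ 2 + x.2 ^ 2)) ≤ 1 / 4 :=
    one_div_le_one_div_of_le (by norm_num) (by linarith)
  linarith

/-- The kernel, cut off at height `R`. -/
noncomputable def truncKer (R : ℝ) : Strip → ℂ := {x : Strip | |x.2| ≤ R}.indicator cker

theorem truncKer_of_le {R : ℝ} {x : Strip} (h : |x.2| ≤ R) : truncKer R x = cker x :=
  Set.indicator_of_mem (s := {x : Strip | |x.2| ≤ R}) h cker

theorem measurableSet_abs_snd_le (R : ℝ) : MeasurableSet {x : Strip | |x.2| ≤ R} :=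
  measurableSet_le (by fun_prop) measurable_const

theorem measurable_truncKer (R : ℝ) : Measurable (truncKer R) :=
  measurable_cker.indicator (measurableSet_abs_snd_le R)

theorem intervalIntegrable_abs_rpow {a b : ℝ} :
    IntervalIntegrable (fun x : ℝ => |x| ^ (-(1 / 2) : ℝ)) volume a b := by
  refine intervalIntegrable_of_even (fun x => by rw [abs_neg]) (fun x hx => ?_)
  refine (intervalIntegral.intervalIntegrable_rpow' (r := -(1 / 2)) (by norm_num)).congr ?_
  intro y hy
  rw [Set.uIoc_of_le hx.le] at hy
  simp only [abs_of_pos hy.1]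

/-- The singularity 1/(4r) is dominated by a product of one-variable functions, |x|^(-1/2)
|y|^(-1/2), since |x||y| ≤ x² + y². Both factors are integrable on bounded intervals, so no polar
coordinates are needed; the bounded part is absorbed by the constant 1 on the box. -/
theorem integrable_truncKer (R : ℝ) : Integrable (truncKer R) := by
  rw [← measurePreserving_proj.integrable_comp (measurable_truncKer R).aestronglyMeasurable]
  have i1 : Integrable (fun x : ℝ => |x| ^ (-(1 / 2) : ℝ))
      (volume.restrict (Set.Ioc (-(1 / 2) : ℝ) (1 / 2))) :=
    (intervalIntegrable_iff_integrableOn_Ioc_of_le (by norm_num)).1 intervalIntegrable_abs_rpow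
  have i2 : Integrable ((Set.Icc (-R) R).indicator fun x : ℝ => |x| ^ (-(1 / 2) : ℝ)) := by
    rw [integrable_indicator_iff measurableSet_Icc]
    rcases le_or_gt (-R) R with h | h
    · rw [integrableOn_Icc_iff_integrableOn_Ioc]
      exact (intervalIntegrable_iff_integrableOn_Ioc_of_le h).1 intervalIntegrable_abs_rpow
    · rw [Set.Icc_eq_empty (by linarith)]
      exact integrableOn_empty
  have i3 : Integrable (fun _ : ℝ => (1 : ℝ))
      (volume.restrict (Set.Ioc (-(1 / 2) : ℝ) (1 / 2))) := integrable_const 1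
  have i4 : Integrable ((Set.Icc (-R) R).indicator fun _ : ℝ => (1 : ℝ)) := by
    rw [integrable_indicator_iff measurableSet_Icc]
    exact integrableOn_const (by simp)
  have hb := (i1.mul_prod i2).add (i3.mul_prod i4)
  refine Integrable.mono' hb
    ((measurable_truncKer R).comp measurePreserving_proj.measurable).aestronglyMeasurable ?_
  filter_upwards [(ae_cell : ∀ᵐ p ∂cellMeasure, _),
    (ae_cell_ne_zero : ∀ᵐ p ∂cellMeasure, _)] with p h1 h2
  simp only [Function.comp, Pi.add_apply]
  by_cases hp : |p.2| ≤ R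
  · have hm : p.2 ∈ Set.Icc (-R) R := abs_le.1 hp
    rw [truncKer_of_le (by exact hp), cker_proj, Set.indicator_of_mem hm,
      Set.indicator_of_mem hm, mul_one]
    refine (norm_halfCot_le _ h1).trans ?_
    have a1 : 0 < |p.1| := abs_pos.2 h2.1
    have a2 : 0 < |p.2| := abs_pos.2 h2.2
    have : 1 / (4 * √(p.1 ^ 2 + p.2 ^ 2)) ≤ |p.1| ^ (-(1 / 2) : ℝ) * |p.2| ^ (-(1 / 2) : ℝ) := by
      rw [← Real.mul_rpow a1.le a2.le, Real.rpow_neg (by positivity), ← Real.sqrt_eq_rpow,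
        ← one_div]
      apply one_div_le_one_div_of_le (Real.sqrt_pos.2 (by positivity))
      have : √(|p.1| * |p.2|) ≤ √(p.1 ^ 2 + p.2 ^ 2) := by
        apply Real.sqrt_le_sqrt
        nlinarith [sq_nonneg (|p.1| - |p.2|), sq_abs p.1, sq_abs p.2]
      nlinarith [Real.sqrt_nonneg (p.1 ^ 2 + p.2 ^ 2)]
    linarith
  · have hm : p.2 ∉ Set.Icc (-R) R := fun h => hp (abs_le.2 h)
    rw [truncKer, Set.indicator_of_notMem (by exact hp), norm_zero,
      Set.indicator_of_notMem hm, Set.indicator_of_notMem hm]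
    simp

theorem integral_eq_integral_cell {g : Strip → ℂ} (hg : AEStronglyMeasurable g volume) :
    ∫ x, g x = ∫ p, g (proj p) ∂cellMeasure := by
  rw [← measurePreserving_proj.map_eq] at hg ⊢
  exact integral_map measurePreserving_proj.measurable.aemeasurable hg

/-! ### Test functions -/

/-- Twice the antiholomorphic derivative `∂₁φ + i ∂₂φ`. -/
noncomputable def dbar (φ : Strip → ℝ) (x : Strip) : ℂ :=
  partialOne φ x + partialTwo φ x * Complex.I

namespace IsTest

variable {φ : Strip → ℝ}

theorem smooth_comp_proj (h : IsTest φ) :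
    ContDiff ℝ ((⊤ : ℕ∞) : WithTop ℕ∞) (fun p => φ (proj p)) := h.smooth

theorem partialOne_proj (h : IsTest φ) (p : ℝ × ℝ) :
    partialOne φ (proj p) = fderiv ℝ (fun p => φ (proj p)) p (1, 0) := by
  have hd := (h.smooth_comp_proj.differentiable (by simp) p).hasFDerivAt
  have hl : HasDerivAt (fun t : ℝ => (p.1 + t, p.2)) (1, 0) 0 :=
    (((hasDerivAt_id (0 : ℝ)).const_add p.1)).prodMk (hasDerivAt_const _ _)
  have := HasFDerivAt.comp_hasDerivAt_of_eq (0 : ℝ) hd hl (by simp)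
  refine Eq.trans ?_ this.deriv
  simp only [partialOne, proj, Function.comp_def, AddCircle.coe_add]

theorem partialTwo_proj (h : IsTest φ) (p : ℝ × ℝ) :
    partialTwo φ (proj p) = fderiv ℝ (fun p => φ (proj p)) p (0, 1) := by
  have hd := (h.smooth_comp_proj.differentiable (by simp) p).hasFDerivAt
  have hl : HasDerivAt (fun t : ℝ => (p.1, p.2 + t)) (0, 1) 0 :=
    (hasDerivAt_const _ _).prodMk ((hasDerivAt_id (0 : ℝ)).const_add p.2)
  have := HasFDerivAt.comp_hasDerivAt_of_eq (0 : ℝ) hd hl (by simp)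
  refine Eq.trans ?_ this.deriv
  simp only [partialTwo, proj, Function.comp_def]

theorem continuous_partialOne (h : IsTest φ) : Continuous (partialOne φ) := by
  rw [isOpenQuotientMap_proj.isQuotientMap.continuous_iff]
  have : partialOne φ ∘ proj = fun p => fderiv ℝ (fun p => φ (proj p)) p (1, 0) :=
    funext h.partialOne_proj
  rw [this]
  exact (h.smooth_comp_proj.continuous_fderiv (by simp)).clm_apply continuous_const

theorem continuous_partialTwo (h : IsTest φ) : Continuous (partialTwo φ) := by
  rw [isOpenQuotientMap_proj.isQuotientMap.continuous_iff]
  have : partialTwo φ ∘ proj = fun p => fderiv ℝ (fun p => φ (proj p)) p (0, 1) :=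
    funext h.partialTwo_proj
  rw [this]
  exact (h.smooth_comp_proj.continuous_fderiv (by simp)).clm_apply continuous_const

theorem exists_height (h : IsTest φ) : ∃ R : ℝ, 0 ≤ R ∧ ∀ x : Strip, R < |x.2| →
    φ x = 0 ∧ partialOne φ x = 0 ∧ partialTwo φ x = 0 := by
  obtain ⟨R, hR⟩ := (h.compactSupport.isCompact.image continuous_snd).isBounded.exists_norm_le
  have h0 : ∀ x : Strip, R < |x.2| → φ x = 0 := by
    intro x hx
    by_contra hne
    exact absurd (hR x.2 ⟨x, subset_tsupport φ hne, rfl⟩) (not_le.2 hx)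
  refine ⟨max R 0, le_max_right _ _, fun x hx => ?_⟩
  have hx' : R < |x.2| := (le_max_left _ _).trans_lt hx
  refine ⟨h0 x hx', ?_, ?_⟩
  · have : (fun t : ℝ => φ (x.1 + (t : AddCircle (1 : ℝ)), x.2)) = fun _ => 0 :=
      funext fun t => h0 _ hx'
    rw [partialOne, this, deriv_const]
  -- Moving vertically changes the height, so φ vanishes only for small t; the strict inequality R <
  -- |x.2| provides the neighbourhood.
  · have hev : (fun t : ℝ => φ (x.1, x.2 + t)) =ᶠ[𝓝 0] fun _ => 0 := by
      have hc : Continuous fun t : ℝ => |x.2 + t| := by fun_prop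
      have : ∀ᶠ t : ℝ in 𝓝 0, R < |x.2 + t| :=
        hc.continuousAt.eventually_mem (by
          simp only [add_zero]; exact Ioi_mem_nhds hx')
      filter_upwards [this] with t ht
      exact h0 _ ht
    rw [partialTwo, hev.deriv_eq, deriv_const]

theorem continuous_dbar (h : IsTest φ) : Continuous (dbar φ) :=
  (Complex.continuous_ofReal.comp h.continuous_partialOne).add
    ((Complex.continuous_ofReal.comp h.continuous_partialTwo).mul continuous_const)

end IsTest

theorem exists_bound_of_height {g : Strip → ℂ} {R : ℝ} (hc : Continuous g)
    (hR : ∀ x : Strip, R < |x.2| → g x = 0) : ∃ M : ℝ, 0 ≤ M ∧ ∀ x, ‖g x‖ ≤ M := by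
  have hK : IsCompact ((Set.univ : Set (AddCircle (1 : ℝ))) ×ˢ Set.Icc (-R) R) :=
    isCompact_univ.prod isCompact_Icc
  obtain ⟨M, hM⟩ := hK.exists_bound_of_continuousOn hc.continuousOn
  refine ⟨max M 0, le_max_right _ _, fun x => ?_⟩
  rcases le_or_gt |x.2| R with h | h
  · exact (hM x ⟨Set.mem_univ _, abs_le.1 h⟩).trans (le_max_left _ _)
  · rw [hR x h, norm_zero]
    exact le_max_right _ _

theorem IsTest.exists_bound_dbar {φ : Strip → ℝ} (h : IsTest φ) :
    ∃ N R : ℝ, (∀ x, ‖dbar φ x‖ ≤ N) ∧ ∀ x : Strip, R < |x.2| → dbar φ x = 0 := by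
  obtain ⟨R, -, hR⟩ := h.exists_height
  have hd : ∀ x : Strip, R < |x.2| → dbar φ x = 0 := by
    intro x hx
    simp [dbar, (hR x hx).2.1, (hR x hx).2.2]
  obtain ⟨N, -, hN⟩ := exists_bound_of_height h.continuous_dbar hd
  exact ⟨N, R, hN, hd⟩

end Strip

/-! ### The kernel as a fundamental solution -/

namespace Strip

variable {φ : Strip → ℝ}

theorem continuousAt_halfCot {x : ℝ} (h0 : x ≠ 0) (hx : |x| ≤ 1 / 2) :
    ContinuousAt halfCot x := by
  have h : Complex.exp (2 * Real.pi * Complex.I * x) - 1 ≠ 0 := by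
    intro h
    obtain ⟨n, hn⟩ := Complex.exp_eq_one_iff.1 (sub_eq_zero.1 h)
    have h1 : (x : ℂ) = n := by
      have := Complex.two_pi_I_ne_zero
      field_simp at hn
      exact hn
    have h2 : x = n := by exact_mod_cast h1
    rw [h2] at hx h0
    have h3 : |n| < 1 := by
      have : |(n : ℝ)| < 1 := by linarith
      exact_mod_cast this
    exact h0 (by exact_mod_cast Int.abs_lt_one_iff.1 h3)
  unfold halfCot
  exact ContinuousAt.div (by fun_prop) (by fun_prop) (by simpa using h)

theorem measurable_halfCot : Measurable halfCot := by
  unfold halfCot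
  fun_prop

/-- The integral of `halfCot` against a test function on the horizontal line at height `y`. -/
noncomputable def lineIntegral (φ : Strip → ℝ) (y : ℝ) : ℂ :=
  ∫ x in (-(1 / 2) : ℝ)..(1 / 2), halfCot (x + y * Complex.I) * φ (proj (x, y))

theorem IsTest.exists_lipschitz (h : IsTest φ) :
    ∃ L : ℝ, 0 ≤ L ∧ ∀ p : ℝ × ℝ, ‖p‖ ≤ 1 → |φ (proj p) - φ 0| ≤ L * ‖p‖ := by
  have hc := h.smooth_comp_proj.continuous_fderiv (by simp)
  obtain ⟨L, hL⟩ :=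
    (isCompact_closedBall (0 : ℝ × ℝ) 1).exists_bound_of_continuousOn hc.continuousOn
  refine ⟨max L 0, le_max_right _ _, fun p hp => ?_⟩
  have := (convex_closedBall (0 : ℝ × ℝ) 1).norm_image_sub_le_of_norm_fderiv_le (𝕜 := ℝ)
    (f := fun p => φ (proj p)) (C := L) (fun x _ => h.smooth_comp_proj.differentiable (by simp) x)
    hL (x := 0) (y := p) (by simp) (by simpa using hp)
  have h0 : proj 0 = 0 := by simp [proj]
  rw [h0, sub_zero, Real.norm_eq_abs] at this
  exact this.trans (mul_le_mul_of_nonneg_right (le_max_left _ _) (norm_nonneg _))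

/-- The factor φ - φ(0) is O(r) and cancels the 1/r singularity of `halfCot`, so the integrands are
bounded by one constant for |y| < 1. Dominated convergence then applies, the integrand being
continuous in y at y = 0 for every x ≠ 0 in the cell. -/
theorem IsTest.continuousAt_integral_halfCot_mul_sub (h : IsTest φ) :
    ContinuousAt (fun y : ℝ => ∫ x in (-(1 / 2) : ℝ)..(1 / 2),
      halfCot (x + y * Complex.I) * (φ (proj (x, y)) - φ 0)) 0 := by
  obtain ⟨L, hL0, hL⟩ := h.exists_lipschitz
  have hφ : Continuous fun p : ℝ × ℝ => φ (proj p) := h.smooth_comp_proj.continuous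
  refine intervalIntegral.continuousAt_of_dominated_interval (bound := fun _ => L) ?_ ?_
    intervalIntegrable_const ?_
  · refine Eventually.of_forall fun y => (Measurable.aestronglyMeasurable ?_)
    have h1 : Measurable fun x : ℝ => φ (proj (x, y)) :=
      (hφ.comp (by fun_prop : Continuous fun x : ℝ => (x, y))).measurable
    exact (measurable_halfCot.comp (by fun_prop)).mul
      ((Complex.measurable_ofReal.comp h1).sub_const _)
  · have : ∀ᶠ y : ℝ in 𝓝 0, |y| < 1 := by
      have hc : Continuous fun t : ℝ => |t| := by fun_prop
      exact hc.continuousAt.eventually_lt continuousAt_const (by simp)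
    filter_upwards [this] with y hy
    refine Eventually.of_forall fun x hx => ?_
    rw [Set.uIoc_of_le (by norm_num)] at hx
    have hx' : |x| ≤ 1 / 2 := abs_le.2 ⟨hx.1.le, hx.2⟩
    have hp : ‖((x, y) : ℝ × ℝ)‖ ≤ 1 := by
      rw [Prod.norm_def, max_le_iff, Real.norm_eq_abs, Real.norm_eq_abs]
      exact ⟨by linarith, hy.le⟩
    have hr : ‖((x, y) : ℝ × ℝ)‖ ≤ √(x ^ 2 + y ^ 2) := by
      rw [Prod.norm_def, max_le_iff, Real.norm_eq_abs, Real.norm_eq_abs]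
      exact ⟨Real.abs_le_sqrt (by nlinarith [sq_nonneg y]),
        Real.abs_le_sqrt (by nlinarith [sq_nonneg x])⟩
    have hb := hL (x, y) hp
    have hh := norm_halfCot_le y hx'
    rw [norm_mul, ← Complex.ofReal_sub, Complex.norm_real, Real.norm_eq_abs]
    calc _ ≤ (1 / 2 + 1 / (4 * √(x ^ 2 + y ^ 2))) * (L * ‖((x, y) : ℝ × ℝ)‖) := by gcongr
      _ = L * (‖((x, y) : ℝ × ℝ)‖ / 2 + ‖((x, y) : ℝ × ℝ)‖ / √(x ^ 2 + y ^ 2) / 4) := by ring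
      _ ≤ L * (1 / 2 + 1 / 4) := by
        gcongr
        exact div_le_one_of_le₀ hr (Real.sqrt_nonneg _)
      _ ≤ L := by linarith
  · have h0 : ∀ᵐ x : ℝ, x ≠ 0 := Measure.ae_ne volume 0
    filter_upwards [h0] with x hx0 hx
    rw [Set.uIoc_of_le (by norm_num)] at hx
    have hx' : |x| ≤ 1 / 2 := abs_le.2 ⟨hx.1.le, hx.2⟩
    refine ContinuousAt.mul ?_ ?_
    · refine ContinuousAt.comp_of_eq (continuousAt_halfCot hx0 hx') (by fun_prop) (by simp)
    · exact ((Complex.continuous_ofReal.comp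
        (hφ.comp (by fun_prop : Continuous fun y : ℝ => (x, y)))).sub continuous_const).continuousAt

theorem continuous_halfCot_line {y : ℝ} (hy : y ≠ 0) :
    Continuous fun x : ℝ => halfCot (x + y * Complex.I) :=
  continuous_iff_continuousAt.2 fun x => ContinuousAt.comp (f := fun x : ℝ => (x + y * Complex.I : ℂ))
    (differentiableAt_halfCot (by simpa using hy)).continuousAt (by fun_prop)

theorem IsTest.continuous_line (h : IsTest φ) (y : ℝ) :
    Continuous fun x : ℝ => (φ (proj (x, y)) : ℂ) :=
  Complex.continuous_ofReal.comp (h.smooth_comp_proj.continuous.comp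
    (by fun_prop : Continuous fun x : ℝ => (x, y)))

/-- Split φ = (φ - φ(0)) + φ(0). The first part gives a function of y continuous at 0, so its jump
vanishes; the second contributes φ(0) times the jump 1/2 - (-1/2) of the mean of `halfCot`. -/
theorem IsTest.tendsto_lineIntegral_sub (h : IsTest φ) :
    Tendsto (fun y => lineIntegral φ (-y) - lineIntegral φ y) (𝓝[>] 0) (𝓝 (φ 0)) := by
  have hK := h.continuousAt_integral_halfCot_mul_sub
  set K : ℝ → ℂ := fun y => ∫ x in (-(1 / 2) : ℝ)..(1 / 2),
      halfCot (x + y * Complex.I) * (φ (proj (x, y)) - φ 0) with hKdef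
  have hJ : ∀ y : ℝ, y ≠ 0 → lineIntegral φ y =
      K y + (∫ x in (-(1 / 2) : ℝ)..(1 / 2), halfCot (x + y * Complex.I)) * φ 0 := by
    intro y hy
    have c1 := continuous_halfCot_line hy
    have c2 := h.continuous_line y
    rw [← intervalIntegral.integral_mul_const, hKdef, lineIntegral,
      ← intervalIntegral.integral_add]
    · congr 1
      funext x
      ring
    · exact (c1.mul (c2.sub continuous_const)).intervalIntegrable _ _
    · exact (c1.mul continuous_const).intervalIntegrable _ _
  have h1 : Tendsto (fun y => K (-y) - K y + φ 0) (𝓝[>] 0) (𝓝 (K 0 - K 0 + φ 0)) := by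
    refine Tendsto.add (Tendsto.sub ?_ ?_) tendsto_const_nhds
    · refine Tendsto.comp (y := 𝓝 0) hK ?_
      have : Tendsto (fun y : ℝ => -y) (𝓝 0) (𝓝 (-0)) := continuous_neg.continuousAt
      rw [neg_zero] at this
      exact this.mono_left nhdsWithin_le_nhds
    · exact Tendsto.mono_left hK nhdsWithin_le_nhds
  rw [sub_self, zero_add] at h1
  refine h1.congr' ?_
  filter_upwards [self_mem_nhdsWithin] with y hy
  have hy : 0 < y := hy
  rw [hJ y hy.ne', hJ (-y) (neg_ne_zero.2 hy.ne'), integral_halfCot_of_pos hy,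
    integral_halfCot_of_neg (neg_neg_of_pos hy)]
  ring

/-- Green's theorem in complex form on the rectangle [-1/2, 1/2] × [a, b]. The vertical sides cancel
by periodicity, and since `halfCot` is holomorphic off height 0 the derivative falls on φ alone. -/
theorem IsTest.lineIntegral_sub_lineIntegral (h : IsTest φ) {a b : ℝ} (hab : a ≤ b)
    (h0 : (0 : ℝ) ∉ Set.Icc a b) :
    lineIntegral φ a - lineIntegral φ b =
      Complex.I * ∫ x in (-(1 / 2) : ℝ)..(1 / 2), ∫ y in a..b,
        cker (proj (x, y)) * dbar φ (proj (x, y)) := by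
  have hne : ∀ y ∈ Set.uIcc a b, y ≠ 0 := by
    intro y hy hy0
    rw [Set.uIcc_of_le hab, hy0] at hy
    exact h0 hy
  set Φ : ℂ → ℂ := fun z => (φ (proj (z.re, z.im)) : ℂ) with hΦ
  set F : ℂ → ℂ := fun z => halfCot z * Φ z with hF
  have hΦd : ∀ z, HasFDerivAt Φ (Complex.ofRealCLM.comp
      ((fderiv ℝ (fun p => φ (proj p)) (z.re, z.im)).comp
        (Complex.reCLM.prod Complex.imCLM))) z := by
    intro z
    have h1 := (h.smooth_comp_proj.differentiable (by simp) (z.re, z.im)).hasFDerivAt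
    have h2 : HasFDerivAt (fun z : ℂ => (z.re, z.im)) (Complex.reCLM.prod Complex.imCLM) z :=
      (Complex.reCLM.prod Complex.imCLM).hasFDerivAt
    have h3 := HasFDerivAt.comp z h1 h2
    exact Complex.ofRealCLM.hasFDerivAt.comp z h3
  have hFd : ∀ z : ℂ, z.im ≠ 0 → HasFDerivAt F
      (halfCot z • (Complex.ofRealCLM.comp
      ((fderiv ℝ (fun p => φ (proj p)) (z.re, z.im)).comp
        (Complex.reCLM.prod Complex.imCLM))) +
        Φ z • ((deriv halfCot z) • (1 : ℂ →L[ℝ] ℂ))) z := by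
    intro z hz
    exact HasFDerivAt.mul (differentiableAt_halfCot hz).hasDerivAt.complexToReal_fderiv (hΦd z)
  -- The terms containing the derivative of `halfCot` cancel, because that derivative is complex
  -- linear.
  have hval : ∀ z : ℂ, z.im ≠ 0 → Complex.I • fderiv ℝ F z 1 - fderiv ℝ F z Complex.I =
      Complex.I * (halfCot z * dbar φ (proj (z.re, z.im))) := by
    intro z hz
    rw [(hFd z hz).fderiv, dbar, h.partialOne_proj, h.partialTwo_proj]
    simp
    linear_combination (-halfCot z * fderiv ℝ (fun p => φ (proj p)) (z.re, z.im) (0, 1)) *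
      Complex.I_sq
  have hrect : ∀ z ∈ (Set.uIcc (-(1 / 2) : ℝ) (1 / 2)) ×ℂ (Set.uIcc a b), z.im ≠ 0 :=
    fun z hz => hne _ hz.2
  have key := Complex.integral_boundary_rect_of_differentiableOn_real F
    ⟨-(1 / 2), a⟩ ⟨1 / 2, b⟩
    (fun z hz => (hFd z (hrect z hz)).differentiableAt.differentiableWithinAt) ?_
  · simp only at key
    have hper : ∀ y : ℝ, F (((1 / 2 : ℝ) : ℂ) + y * Complex.I) =
        F (((-(1 / 2) : ℝ) : ℂ) + y * Complex.I) := by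
      intro y
      have e1 : (((1 / 2 : ℝ) : ℂ) + y * Complex.I) =
        (((-(1 / 2) : ℝ) : ℂ) + y * Complex.I) + 1 := by push_cast; ring
      have e2 : proj (-(1 / 2) + 1, y) = proj (-(1 / 2), y) := by
        have : ((-(1 / 2) + 1 : ℝ) : AddCircle (1 : ℝ)) = ((-(1 / 2) : ℝ) : AddCircle (1 : ℝ)) := by
          rw [AddCircle.coe_add, AddCircle.coe_period, add_zero]
        simp only [proj, this]
      rw [e1]
      rw [one_div] at e2
      simp only [hF, hΦ, halfCot_add_one]
      simp [e2]
    rw [show (∫ y in a..b, F (((1 / 2 : ℝ) : ℂ) + y * Complex.I)) =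
      ∫ y in a..b, F (((-(1 / 2) : ℝ) : ℂ) + y * Complex.I) from
        intervalIntegral.integral_congr fun y _ => hper y, add_sub_cancel_right] at key
    have hl : ∀ y : ℝ, ∫ x in (-(1 / 2) : ℝ)..(1 / 2), F (x + y * Complex.I) =
        lineIntegral φ y := by
      intro y
      simp [lineIntegral, hF, hΦ]
    rw [hl, hl] at key
    rw [key, ← intervalIntegral.integral_const_mul]
    refine intervalIntegral.integral_congr fun x _ => ?_
    rw [← intervalIntegral.integral_const_mul]
    refine intervalIntegral.integral_congr fun y hy => ?_
    rw [hval _ (by simpa using hne y hy), cker_proj]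
    simp
  · have hK : IsCompact ((Set.uIcc (-(1 / 2) : ℝ) (1 / 2)) ×ℂ (Set.uIcc a b)) :=
      isCompact_uIcc.reProdIm isCompact_uIcc
    have hc : ContinuousOn (fun z : ℂ => Complex.I * (halfCot z * dbar φ (proj (z.re, z.im))))
        ((Set.uIcc (-(1 / 2) : ℝ) (1 / 2)) ×ℂ (Set.uIcc a b)) := by
      refine continuousOn_const.mul (ContinuousOn.mul ?_ ?_)
      · exact fun z hz => (differentiableAt_halfCot (hrect z hz)).continuousAt.continuousWithinAt
      · exact (h.continuous_dbar.comp (continuous_proj.comp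
          (Complex.continuous_re.prodMk Complex.continuous_im))).continuousOn
    refine (hc.integrableOn_compact hK).congr_fun (fun z hz => (hval z (hrect z hz)).symm)
      hK.measurableSet

theorem IsTest.integrable_cker_mul_dbar (h : IsTest φ) :
    Integrable fun x => cker x * dbar φ x := by
  obtain ⟨M, R, hM, hd⟩ := h.exists_bound_dbar
  have := (integrable_truncKer R).mul_bdd (c := M) h.continuous_dbar.aestronglyMeasurable
    (Eventually.of_forall hM)
  refine this.congr (Eventually.of_forall fun x => ?_)
  simp only
  rcases le_or_gt |x.2| R with hx | hx
  · rw [truncKer_of_le hx]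
  · rw [hd x hx, mul_zero, mul_zero]

/-- The kernel is divergence free, and its curl is the Dirac mass at `0`. -/
theorem IsTest.integral_cker_mul_dbar (h : IsTest φ) :
    ∫ x, cker x * dbar φ x = Complex.I * φ 0 := by
  have hint := h.integrable_cker_mul_dbar
  obtain ⟨R₀, hR₀, hR⟩ := h.exists_height
  -- The extra 1 makes everything vanish on the lines of height ±R themselves.
  set R := R₀ + 1 with hRdef
  have hRpos : 0 < R := by linarith
  set G : ℝ × ℝ → ℂ := fun p => cker (proj p) * dbar φ (proj p) with hG
  have hGi : Integrable G cellMeasure := measurePreserving_proj.integrable_comp_of_integrable hint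
  set H : ℝ → ℂ := fun y => ∫ x in (-(1 / 2) : ℝ)..(1 / 2), G (x, y) with hH
  have hle : (-(1 / 2) : ℝ) ≤ 1 / 2 := by norm_num
  have hHi : Integrable H := by
    simp only [hH, intervalIntegral.integral_of_le hle]
    exact hGi.integral_prod_right
  have hswap : ∀ a b : ℝ, a ≤ b →
      ∫ x in (-(1 / 2) : ℝ)..(1 / 2), ∫ y in a..b, G (x, y) = ∫ y in a..b, H y := by
    intro a b hab
    simp only [hH, intervalIntegral.integral_of_le hle, intervalIntegral.integral_of_le hab]
    refine integral_integral_swap (f := fun x y => G (x, y)) ?_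
    refine hGi.mono_measure ?_
    rw [cellMeasure]
    exact Measure.prod_mono le_rfl Measure.restrict_le_self
  have hzero : ∀ y : ℝ, R ≤ |y| → lineIntegral φ y = 0 ∧ H y = 0 := by
    intro y hy
    have h1 : ∀ x : ℝ, φ (proj (x, y)) = 0 ∧ _ := fun x => hR (proj (x, y)) (by
      simp only [proj]; linarith)
    constructor
    · simp [lineIntegral, (h1 _).1]
    · simp [hH, hG, dbar, (h1 _).2.1, (h1 _).2.2]
  have hI2 := Complex.I_sq
  have hup : ∀ ε, 0 < ε → ε ≤ R → ∫ y in ε..R, H y = -Complex.I * lineIntegral φ ε := by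
    intro ε h1 h2
    have := h.lineIntegral_sub_lineIntegral h2 (fun h => absurd h.1 (not_le.2 h1))
    rw [(hzero R (le_abs_self R)).1, sub_zero] at this
    rw [this, ← hswap ε R h2]
    linear_combination (∫ x in (-(1 / 2) : ℝ)..(1 / 2), ∫ y in ε..R, G (x, y)) * hI2
  have hdown : ∀ ε, 0 < ε → ε ≤ R →
      ∫ y in (-R)..(-ε), H y = Complex.I * lineIntegral φ (-ε) := by
    intro ε h1 h2
    have := h.lineIntegral_sub_lineIntegral (neg_le_neg h2)
      (fun h => absurd h.2 (not_le.2 (neg_neg_of_pos h1)))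
    rw [(hzero (-R) (by rw [abs_neg]; exact le_abs_self R)).1, zero_sub] at this
    rw [← neg_neg (lineIntegral φ (-ε)), this, ← hswap (-R) (-ε) (neg_le_neg h2)]
    linear_combination (∫ x in (-(1 / 2) : ℝ)..(1 / 2), ∫ y in (-R)..(-ε), G (x, y)) * hI2
  have hH' : ∀ a b, IntervalIntegrable H volume a b := fun a b => hHi.intervalIntegrable
  -- The slab |y| < ε around the pole can be shrunk because H is integrable, so its contribution
  -- disappears in the limit.
  have hlim1 : Tendsto (fun ε => (∫ y in (-R)..(-ε), H y) + ∫ y in ε..R, H y) (𝓝[>] 0)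
      (𝓝 ((∫ y in (-R)..0, H y) + ∫ y in (0 : ℝ)..R, H y)) := by
    have c : Continuous fun ε : ℝ => (∫ y in (-R)..(-ε), H y) + ∫ y in ε..R, H y := by
      refine Continuous.add ((intervalIntegral.continuous_primitive hH' (-R)).comp continuous_neg) ?_
      have : (fun ε : ℝ => ∫ y in ε..R, H y) = fun ε => -∫ y in R..ε, H y := by
        funext ε
        rw [intervalIntegral.integral_symm]
      rw [this]
      exact (intervalIntegral.continuous_primitive hH' R).neg
    have := c.tendsto 0
    rw [neg_zero] at this
    exact this.mono_left nhdsWithin_le_nhds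
  have hlim2 := (h.tendsto_lineIntegral_sub.const_mul Complex.I)
  have heq := tendsto_nhds_unique hlim1 (hlim2.congr' (by
    filter_upwards [Ioc_mem_nhdsGT hRpos] with ε hε
    rw [hup ε hε.1 hε.2, hdown ε hε.1 hε.2]
    ring))
  rw [intervalIntegral.integral_add_adjacent_intervals (hH' _ _) (hH' _ _)] at heq
  rw [← heq, integral_eq_integral_cell hint.aestronglyMeasurable,
    intervalIntegral.integral_of_le (by linarith),
    setIntegral_eq_integral_of_forall_compl_eq_zero]
  · rw [cellMeasure, integral_prod_symm _ hGi]
    simp only [hH, intervalIntegral.integral_of_le hle]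
  · intro y hy
    refine (hzero y ?_).2
    by_contra hlt
    rw [not_le, abs_lt] at hlt
    exact hy ⟨hlt.1, hlt.2.le⟩

end Strip

/-! ### The convolution with a bounded, compactly supported vorticity -/

namespace Strip

instance : (volume : Measure Strip).IsAddLeftInvariant :=
  inferInstanceAs ((volume : Measure (AddCircle (1 : ℝ))).prod
    (volume : Measure ℝ)).IsAddLeftInvariant

instance : (volume : Measure Strip).IsNegInvariant :=
  ⟨((Measure.measurePreserving_neg (volume : Measure (AddCircle (1 : ℝ)))).prod
    (Measure.measurePreserving_neg (volume : Measure ℝ))).map_eq⟩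

theorem volume_real_univ_circle : (volume : Measure (AddCircle (1 : ℝ))).real Set.univ = 1 := by
  simp [measureReal_def, AddCircle.measure_univ]

/-- `ω` is measurable, bounded by `M`, and vanishes above height `R`. -/
structure BoundedOn (ω : Strip → ℝ) (M R : ℝ) : Prop where
  aestronglyMeasurable : AEStronglyMeasurable ω volume
  nonneg : 0 ≤ M
  bound : ∀ᵐ x, |ω x| ≤ M
  height : ∀ᵐ x : Strip, R < |x.2| → ω x = 0

theorem exists_ae_norm_le_of_memLp_top {E : Type*} [NormedAddCommGroup E] {f : Strip → E}
    (hf : MemLp f ∞ volume) : ∃ N : ℝ, ∀ᵐ x, ‖f x‖ ≤ N := by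
  refine ⟨(eLpNormEssSup f volume).toReal, ?_⟩
  have hfin : eLpNormEssSup f volume ≠ ∞ := by
    have := hf.2.ne
    rwa [eLpNorm_exponent_top] at this
  filter_upwards [ae_le_eLpNormEssSup (f := f) (μ := volume)] with x hx
  have := ENNReal.toReal_mono hfin hx
  rwa [toReal_enorm] at this

theorem MemLinftyC.exists_boundedOn {ω : Strip → ℝ} (h : MemLinftyC ω) :
    ∃ M R : ℝ, BoundedOn ω M R := by
  obtain ⟨hm, C, hC, h0⟩ := h
  obtain ⟨R, hR⟩ := (hC.image continuous_snd).isBounded.exists_norm_le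
  obtain ⟨M, hM⟩ := exists_ae_norm_le_of_memLp_top hm
  refine ⟨max M 0, R, hm.1, le_max_right _ _, hM.mono fun x hx => hx.trans (le_max_left _ _), ?_⟩
  filter_upwards [h0] with x hx hxR
  exact hx fun hxC => absurd (hR x.2 ⟨x, hxC, rfl⟩) (not_le.2 hxR)

theorem volume_abs_snd_le_lt_top (R : ℝ) : volume {x : Strip | |x.2| ≤ R} < ∞ := by
  have : {x : Strip | |x.2| ≤ R} = Set.univ ×ˢ Set.Icc (-R) R := by
    ext x
    simp [abs_le]
  rw [this, Measure.volume_eq_prod, Measure.prod_prod]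
  exact ENNReal.mul_lt_top (measure_lt_top _ _) (by simp)

theorem integrable_of_height {E : Type*} [NormedAddCommGroup E] {g : Strip → E} {N R : ℝ}
    (hg : AEStronglyMeasurable g volume) (hN : ∀ᵐ x, ‖g x‖ ≤ N)
    (hR : ∀ᵐ x : Strip, R < |x.2| → g x = 0) : Integrable g := by
  have h1 : IntegrableOn g {x : Strip | |x.2| ≤ R} :=
    Measure.integrableOn_of_bounded (volume_abs_snd_le_lt_top R).ne hg (ae_restrict_of_ae hN)
  refine (integrable_indicator_iff (measurableSet_abs_snd_le R)).2 h1 |>.congr ?_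
  filter_upwards [hR] with x hx
  by_cases h : |x.2| ≤ R
  · exact Set.indicator_of_mem (s := {x : Strip | |x.2| ≤ R}) h g
  · rw [hx (not_le.1 h)]
    exact Set.indicator_of_notMem (s := {x : Strip | |x.2| ≤ R}) h g

/-- The left inverse of `toComplex`. -/
noncomputable def ofComplex : ℂ →L[ℝ] ℝ × ℝ := Complex.reCLM.prod (-Complex.imCLM)

@[simp] theorem ofComplex_toComplex (v : ℝ × ℝ) : ofComplex (toComplex v) = v := by
  simp [ofComplex]

@[simp] theorem toComplex_ofComplex (z : ℂ) : toComplex (ofComplex z) = z := by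
  simp [ofComplex, toComplex_apply]

/-- The convolution of `ω` with the complex kernel. -/
noncomputable def conv (ω : Strip → ℝ) (x : Strip) : ℂ := ∫ y, (ω y : ℂ) * cker (x - y)

theorem toComplex_smul_kernel (t : ℝ) (x : Strip) :
    toComplex (t • kernel x) = (t : ℂ) * cker x := by
  rw [map_smul, Complex.real_smul, cker]

namespace BoundedOn

variable {ω : Strip → ℝ} {M R : ℝ}

theorem integrable (h : BoundedOn ω M R) : Integrable ω :=
  integrable_of_height h.aestronglyMeasurable h.bound h.height

/-- Where ω does not vanish, |x.2 - y.2| ≤ |x.2| + R, so the kernel may be replaced by its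
integrable truncation at that height. -/
theorem integrable_mul_cker (h : BoundedOn ω M R) (x : Strip) :
    Integrable fun y => (ω y : ℂ) * cker (x - y) := by
  have hk : Integrable fun y => truncKer (|x.2| + R) (x - y) :=
    (integrable_truncKer (|x.2| + R)).comp_sub_left x
  have := hk.bdd_mul (f := fun y => (ω y : ℂ)) (c := M)
    (Complex.continuous_ofReal.comp_aestronglyMeasurable h.aestronglyMeasurable)
    (by simpa using h.bound)
  refine this.congr ?_
  filter_upwards [h.height] with y hy
  rcases le_or_gt |y.2| R with hR | hR
  · rw [truncKer_of_le]
    exact (abs_sub _ _).trans (by simpa using hR)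
  · simp [hy hR]

theorem integrable_smul_kernel (h : BoundedOn ω M R) (x : Strip) :
    Integrable fun y => ω y • kernel (x - y) := by
  have := ofComplex.integrable_comp (h.integrable_mul_cker x)
  refine this.congr (Eventually.of_forall fun y => ?_)
  simp only
  rw [← toComplex_smul_kernel, ofComplex_toComplex]

theorem toComplex_biotSavart (h : BoundedOn ω M R) (x : Strip) :
    toComplex (biotSavart ω x) = conv ω x := by
  rw [biotSavart, ← toComplex.integral_comp_comm (h.integrable_smul_kernel x), conv]
  simp_rw [toComplex_smul_kernel]

theorem stronglyMeasurable_conv (h : BoundedOn ω M R) : StronglyMeasurable (conv ω) := by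
  -- Joint measurability needs a strongly measurable representative of ω; changing ω on a null set
  -- alters the integral at no x.
  obtain ⟨ω', hω', heq⟩ := h.aestronglyMeasurable
  have hm := hω'.measurable
  have e : conv ω = fun x => ∫ y, (ω' y : ℂ) * cker (x - y) := by
    funext x
    refine integral_congr_ae ?_
    filter_upwards [heq] with y hy
    rw [hy]
  rw [e]
  refine StronglyMeasurable.integral_prod_right
    (f := fun x y : Strip => (ω' y : ℂ) * cker (x - y)) ?_
  refine Measurable.stronglyMeasurable ?_
  exact (Complex.measurable_ofReal.comp (hm.comp measurable_snd)).mul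
    (measurable_cker.comp measurable_sub)

/-- The integrand is at most M |K| at height differences up to 1, and at most |ω| beyond, where |K|
≤ 1. Both majorants have integrals independent of x. -/
theorem exists_norm_conv_le (h : BoundedOn ω M R) : ∃ N : ℝ, 0 ≤ N ∧ ∀ x, ‖conv ω x‖ ≤ N := by
  refine ⟨M * (∫ y, ‖truncKer 1 y‖) + ∫ y, |ω y|, ?_, fun x => ?_⟩
  · have := h.nonneg
    positivity
  have i1 : Integrable fun y => M * ‖truncKer 1 (x - y)‖ :=
    ((integrable_truncKer 1).comp_sub_left x).norm.const_mul M
  have i2 : Integrable fun y => |ω y| := h.integrable.abs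
  have e : ∫ y, ‖truncKer 1 y‖ = ∫ y, ‖truncKer 1 (x - y)‖ :=
    (integral_sub_left_eq_self (fun y => ‖truncKer 1 y‖) volume x).symm
  rw [e, ← integral_const_mul, ← integral_add i1 i2]
  refine norm_integral_le_of_norm_le (i1.add i2) ?_
  filter_upwards [h.bound] with y hy
  rw [norm_mul, Complex.norm_real, Real.norm_eq_abs]
  rcases le_or_gt |(x - y).2| 1 with h1 | h1
  · rw [truncKer_of_le h1]
    have := mul_le_mul_of_nonneg_right hy (norm_nonneg (cker (x - y)))
    linarith [abs_nonneg (ω y)]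
  · have h2 := mul_le_mul_of_nonneg_left (norm_cker_le h1.le) (abs_nonneg (ω y))
    have h3 : 0 ≤ M * ‖truncKer 1 (x - y)‖ := mul_nonneg h.nonneg (norm_nonneg _)
    linarith

/-- Fubini's theorem for the convolution, tested against a bounded function of bounded height. -/
theorem integral_conv_mul (h : BoundedOn ω M R) {g : Strip → ℂ} {N R' : ℝ}
    (hg : AEStronglyMeasurable g volume) (hN : ∀ x, ‖g x‖ ≤ N)
    (hR' : ∀ x : Strip, R' < |x.2| → g x = 0) :
    ∫ x, conv ω x * g x = ∫ y, (ω y : ℂ) * ∫ x, cker (x - y) * g x := by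
  have hωC : Integrable fun y => (ω y : ℂ) := h.integrable.ofReal
  -- Heights at most R' for x and R for y leave only height differences up to R' + R, so truncating
  -- there changes nothing and gives joint integrability.
  have i1 := (hωC.convolution_integrand (ContinuousLinearMap.mul ℝ ℂ)
    (integrable_truncKer (R' + R))).mul_bdd (c := N) (g := fun p : Strip × Strip => g p.1)
    hg.comp_fst (Eventually.of_forall fun p => hN p.1)
  simp only [ContinuousLinearMap.mul_apply'] at i1
  have hA : ∀ᵐ y, ∀ x, (ω y : ℂ) * truncKer (R' + R) (x - y) * g x =
      (ω y : ℂ) * cker (x - y) * g x := by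
    filter_upwards [h.height] with y hy x
    rcases le_or_gt |y.2| R with h1 | h1
    · rcases le_or_gt |x.2| R' with h2 | h2
      · rw [truncKer_of_le]
        exact (abs_sub _ _).trans (add_le_add h2 h1)
      · simp [hR' x h2]
    · simp [hy h1]
  calc ∫ x, conv ω x * g x
      = ∫ x, ∫ y, (ω y : ℂ) * truncKer (R' + R) (x - y) * g x := by
        congr 1
        funext x
        rw [conv, ← integral_mul_const]
        refine integral_congr_ae ?_
        filter_upwards [hA] with y hy
        exact (hy x).symm
    _ = ∫ y, ∫ x, (ω y : ℂ) * truncKer (R' + R) (x - y) * g x := integral_integral_swap i1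
    _ = ∫ y, (ω y : ℂ) * ∫ x, cker (x - y) * g x := by
        refine integral_congr_ae ?_
        filter_upwards [hA] with y hy
        rw [← integral_const_mul]
        congr 1
        funext x
        rw [hy x, mul_assoc]

end BoundedOn

/-! ### Translation of test functions -/

theorem IsTest.comp_add_right {φ : Strip → ℝ} (h : IsTest φ) (y : Strip) :
    IsTest fun x => φ (x + y) := by
  refine ⟨?_, h.compactSupport.comp_homeomorph (Homeomorph.addRight y)⟩
  obtain ⟨s, -, hs⟩ := exists_proj y
  have : (fun p : ℝ × ℝ => φ (((p.1 : AddCircle (1 : ℝ)), p.2) + y)) =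
      (fun p => φ (proj p)) ∘ fun p : ℝ × ℝ => p + (s, y.2) := by
    funext p
    rw [← hs]
    simp [proj]
  rw [this]
  exact h.smooth_comp_proj.comp (by fun_prop)

theorem dbar_comp_add_right (φ : Strip → ℝ) (x y : Strip) :
    dbar (fun x => φ (x + y)) x = dbar φ (x + y) := by
  simp only [dbar, partialOne, partialTwo, Prod.add_def, add_right_comm]

theorem BoundedOn.integral_conv_mul_dbar {ω : Strip → ℝ} {M R : ℝ} (h : BoundedOn ω M R)
    {φ : Strip → ℝ} (hφ : IsTest φ) :
    ∫ x, conv ω x * dbar φ x = Complex.I * ∫ y, (ω y : ℂ) * φ y := by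
  obtain ⟨N, R', hN, hR'⟩ := hφ.exists_bound_dbar
  rw [h.integral_conv_mul hφ.continuous_dbar.aestronglyMeasurable hN hR', ← integral_const_mul]
  congr 1
  funext y
  have e : ∫ x, cker (x - y) * dbar φ x = Complex.I * φ y := by
    rw [← integral_add_right_eq_self (fun x => cker (x - y) * dbar φ x) y]
    have := (hφ.comp_add_right y).integral_cker_mul_dbar
    rw [zero_add] at this
    rw [← this]
    simp_rw [dbar_comp_add_right, add_sub_cancel_right]
  rw [e]
  ring

/-! ### Mean values -/

/-- Weak form of m₂ = 0: after Fubini, each horizontal slice is the integral of an odd function on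
the circle. -/
theorem integral_conv_mul_height_im {ω : Strip → ℝ} {M R : ℝ} (h : BoundedOn ω M R) {ψ : ℝ → ℝ}
    (hψ : Continuous ψ) (hs : HasCompactSupport ψ) : (∫ x, conv ω x * ψ x.2).im = 0 := by
  obtain ⟨R', hR'⟩ := hs.isCompact.isBounded.exists_norm_le
  have h0 : ∀ t : ℝ, R' < |t| → ψ t = 0 := by
    intro t ht
    by_contra hne
    exact absurd (hR' t (subset_tsupport ψ hne)) (not_le.2 ht)
  obtain ⟨N, hN⟩ := hs.exists_bound_of_continuous hψ
  have hc : Continuous fun x : Strip => (ψ x.2 : ℂ) := by fun_prop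
  rw [h.integral_conv_mul (N := N) (R' := R') hc.aestronglyMeasurable
    (fun x => by simpa using hN x.2) (fun x hx => by simp [h0 x.2 hx])]
  have key : ∀ y : Strip, (∫ x, cker (x - y) * ψ x.2).im = 0 := by
    intro y
    rw [← integral_add_right_eq_self (fun x : Strip => cker (x - y) * ψ x.2) y]
    simp only [add_sub_cancel_right]
    have hi : Integrable fun x : Strip => cker x * ψ (x + y).2 := by
      have := (integrable_truncKer (R' + |y.2|)).mul_bdd (c := N)
        (g := fun x : Strip => (ψ (x + y).2 : ℂ))
        (by fun_prop : Continuous fun x : Strip => (ψ (x + y).2 : ℂ)).aestronglyMeasurable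
        (Eventually.of_forall fun x => by simpa using hN (x + y).2)
      refine this.congr (Eventually.of_forall fun x => ?_)
      simp only
      rcases le_or_gt |x.2| (R' + |y.2|) with h1 | h1
      · rw [truncKer_of_le h1]
      · have : R' < |(x + y).2| := by
          have h2 := abs_sub_abs_le_abs_sub x.2 (-y.2)
          rw [abs_neg, sub_neg_eq_add] at h2
          simp only [Prod.snd_add]
          linarith
        rw [h0 _ this]
        simp
    have e1 : (∫ x : Strip, cker x * ψ (x + y).2).im =
        ∫ x : Strip, (cker x * ψ (x + y).2).im :=
      (Complex.imCLM.integral_comp_comm hi).symm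
    rw [e1]
    have hi2 : Integrable fun x : Strip => (cker x * ψ (x + y).2).im :=
      Complex.imCLM.integrable_comp hi
    rw [Measure.volume_eq_prod, integral_prod_symm _ (by simpa [Measure.volume_eq_prod] using hi2)]
    refine integral_eq_zero_of_ae (Eventually.of_forall fun a => ?_)
    simp only [Pi.zero_apply, Complex.im_mul_ofReal, cker, toComplex_im, Prod.snd_add]
    -- No integrability of the slice is required: at height 0 the kernel is not integrable along the
    -- circle, and there the integral may be the default value 0, which still satisfies the
    -- identity.
    have e2 := integral_neg_eq_self (fun s : AddCircle (1 : ℝ) =>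
      -(kernel (s, a)).2 * ψ (a + y.2)) volume
    simp only [kernel_neg_left] at e2
    have e3 : ∫ s : AddCircle (1 : ℝ), - -(kernel (s, a)).2 * ψ (a + y.2) =
      -∫ s : AddCircle (1 : ℝ), -(kernel (s, a)).2 * ψ (a + y.2) := by
      rw [← integral_neg]
      simp
    linarith
  -- If the integrand were not integrable, its integral would be 0 by convention, so both cases give
  -- the claim.
  by_cases hi : Integrable fun y => (ω y : ℂ) * ∫ x, cker (x - y) * ψ x.2
  · have e1 := (Complex.imCLM.integral_comp_comm hi).symm
    refine Eq.trans e1 ?_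
    simp [key]
  · rw [integral_undef hi, Complex.zero_im]

theorem norm_cker_add_half_le {x : Strip} (hx : 0 < x.2) :
    ‖cker x + 1 / 2‖ ≤ Real.exp (-(2 * Real.pi * x.2)) / (1 - Real.exp (-(2 * Real.pi * x.2))) := by
  obtain ⟨s, -, hs⟩ := exists_proj x
  have h := norm_halfCot_add_half_le (z := (s : ℂ) + x.2 * Complex.I) (by simpa using hx)
  have e := cker_proj (s, x.2)
  rw [hs] at e
  rw [e]
  simpa using h

theorem exp_div_one_sub_exp_le {a b : ℝ} (ha : 0 < a) (hab : a ≤ b) :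
    Real.exp (-(2 * Real.pi * b)) / (1 - Real.exp (-(2 * Real.pi * b))) ≤
      Real.exp (-(2 * Real.pi * a)) / (1 - Real.exp (-(2 * Real.pi * a))) := by
  have h1 : Real.exp (-(2 * Real.pi * a)) < 1 := by
    rw [Real.exp_lt_one_iff]
    have := mul_pos Real.pi_pos ha
    linarith
  have h2 : Real.exp (-(2 * Real.pi * b)) ≤ Real.exp (-(2 * Real.pi * a)) := by
    rw [Real.exp_le_exp]
    have := mul_le_mul_of_nonneg_left hab Real.pi_pos.le
    linarith
  have := Real.exp_pos (-(2 * Real.pi * a))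
  apply div_le_div₀ this.le h2 (by linarith) (by linarith)

theorem tendsto_exp_div_one_sub_exp (R c : ℝ) :
    Tendsto (fun a => Real.exp (-(2 * Real.pi * (a - R))) /
      (1 - Real.exp (-(2 * Real.pi * (a - R)))) * c) atTop (𝓝 0) := by
  have h1 : Tendsto (fun a : ℝ => Real.exp (-(2 * Real.pi * (a - R)))) atTop (𝓝 0) := by
    refine Real.tendsto_exp_atBot.comp (tendsto_neg_atTop_atBot.comp ?_)
    exact (tendsto_atTop_add_const_right atTop (-R) tendsto_id).const_mul_atTop (by positivity)
  have := (h1.div (h1.const_sub 1) (by norm_num)).mul_const c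
  simpa using this

namespace BoundedOn

variable {ω : Strip → ℝ} {M R : ℝ}

/-- Used with c = ∓1/2, the limits of the kernel at the two ends: the difference is ∫ ω (K - c), and
only heights up to R contribute. -/
theorem norm_conv_sub_le (h : BoundedOn ω M R) (x : Strip) (c : ℂ) {ε : ℝ}
    (hc : ∀ y : Strip, |y.2| ≤ R → ‖cker (x - y) - c‖ ≤ ε) :
    ‖conv ω x - c * ∫ y, ω y‖ ≤ ε * ∫ y, |ω y| := by
  have hωC : Integrable fun y => (ω y : ℂ) := h.integrable.ofReal
  have e : conv ω x - c * ∫ y, ω y = ∫ y, (ω y : ℂ) * (cker (x - y) - c) := by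
    have : ((∫ y, ω y : ℝ) : ℂ) = ∫ y, (ω y : ℂ) := integral_ofReal.symm
    rw [conv, this, ← integral_const_mul,
      ← integral_sub (h.integrable_mul_cker x) (hωC.const_mul c)]
    congr 1
    funext y
    ring
  rw [e, ← integral_const_mul]
  refine norm_integral_le_of_norm_le (h.integrable.abs.const_mul ε) ?_
  filter_upwards [h.height] with y hy
  rw [norm_mul, Complex.norm_real, Real.norm_eq_abs, mul_comm]
  rcases le_or_gt |y.2| R with h1 | h1
  · exact mul_le_mul_of_nonneg_right (hc y h1) (abs_nonneg _)
  · simp [hy h1]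

theorem biotSavart_fst (h : BoundedOn ω M R) (x : Strip) :
    (biotSavart ω x).1 = (conv ω x).re := by
  rw [← h.toComplex_biotSavart, toComplex_re]

theorem biotSavart_snd (h : BoundedOn ω M R) (x : Strip) :
    (biotSavart ω x).2 = -(conv ω x).im := by
  rw [← h.toComplex_biotSavart, toComplex_im, neg_neg]

theorem integrable_conv_line (h : BoundedOn ω M R) (a : ℝ) :
    Integrable fun s : AddCircle (1 : ℝ) => conv ω (s, a) := by
  obtain ⟨N, -, hN⟩ := h.exists_norm_conv_le
  exact Integrable.of_bound (h.stronglyMeasurable_conv.comp_measurable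
    (by fun_prop : Measurable fun s : AddCircle (1 : ℝ) => ((s, a) : Strip))).aestronglyMeasurable
    N (Eventually.of_forall fun s => hN _)

theorem abs_m1_sub_le (h : BoundedOn ω M R) (a : ℝ) (c : ℝ) {ε : ℝ}
    (hc : ∀ x : Strip, |a - x.2| ≤ R → ‖cker x - c‖ ≤ ε) :
    |m1 (biotSavart ω) a - c * ∫ y, ω y| ≤ ε * ∫ y, |ω y| := by
  have e : m1 (biotSavart ω) a - c * ∫ y, ω y =
      ∫ s : AddCircle (1 : ℝ), ((conv ω (s, a)).re - c * ∫ y, ω y) := by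
    have hi : Integrable fun s : AddCircle (1 : ℝ) => (conv ω (s, a)).re :=
      Complex.reCLM.integrable_comp (h.integrable_conv_line a)
    rw [integral_sub hi (integrable_const _), integral_const, volume_real_univ_circle]
    simp [m1, h.biotSavart_fst]
  rw [e]
  have := norm_integral_le_of_norm_le_const (μ := (volume : Measure (AddCircle (1 : ℝ))))
    (f := fun s : AddCircle (1 : ℝ) => (conv ω (s, a)).re - c * ∫ y, ω y)
    (C := ε * ∫ y, |ω y|) (Eventually.of_forall fun s => ?_)
  · simpa [volume_real_univ_circle] using this
  · have h1 := h.norm_conv_sub_le (s, a) c (ε := ε) (fun y hy => hc _ (by simpa using hy))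
    have h2 := (Complex.abs_re_le_norm _).trans h1
    simpa using h2

/-- Above height R, all relevant differences x - y have height at least a - R, where the kernel is
exponentially close to -1/2, uniformly in the circle variable. The lower end follows in the same way
from oddness of the kernel. -/
theorem hasM1Top (h : BoundedOn ω M R) : HasM1Top (biotSavart ω) (-(1 / 2) * ∫ y, ω y) := by
  have key : Tendsto (m1 (biotSavart ω)) atTop (𝓝 (-(1 / 2) * ∫ y, ω y)) := by
    rw [tendsto_iff_norm_sub_tendsto_zero]
    refine squeeze_zero' (Eventually.of_forall fun _ => norm_nonneg _) ?_
      (tendsto_exp_div_one_sub_exp R (∫ y, |ω y|))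
    filter_upwards [eventually_gt_atTop R] with a ha
    refine h.abs_m1_sub_le a (-(1 / 2)) fun x hx => ?_
    have hx2 : a - R ≤ x.2 := by linarith [(abs_le.1 hx).2]
    have := (norm_cker_add_half_le (x := x) (by linarith)).trans
      (exp_div_one_sub_exp_le (by linarith) hx2)
    refine le_trans (le_of_eq ?_) this
    congr 1
    push_cast
    ring
  exact key.mono_left inf_le_left

theorem hasM1Bot (h : BoundedOn ω M R) : HasM1Bot (biotSavart ω) (1 / 2 * ∫ y, ω y) := by
  have key : Tendsto (m1 (biotSavart ω)) atBot (𝓝 (1 / 2 * ∫ y, ω y)) := by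
    rw [tendsto_iff_norm_sub_tendsto_zero]
    refine squeeze_zero' (Eventually.of_forall fun _ => norm_nonneg _) ?_
      ((tendsto_exp_div_one_sub_exp R (∫ y, |ω y|)).comp tendsto_neg_atBot_atTop)
    filter_upwards [eventually_lt_atBot (-R)] with a ha
    refine h.abs_m1_sub_le a (1 / 2) fun x hx => ?_
    have hx2 : -a - R ≤ (-x).2 := by
      have := (abs_le.1 hx).1
      simp only [Prod.snd_neg]
      linarith
    have := (norm_cker_add_half_le (x := -x) (by linarith)).trans
      (exp_div_one_sub_exp_le (by linarith) hx2)
    refine le_trans (le_of_eq ?_) this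
    rw [cker_neg, ← norm_neg]
    congr 1
    push_cast
    ring
  exact key.mono_left inf_le_left

/-- The function m₂ is bounded and measurable, and its integral against every test function of the
height vanishes by reflection; hence it is zero almost everywhere. -/
theorem hasM2 (h : BoundedOn ω M R) : HasM2 (biotSavart ω) 0 := by
  obtain ⟨N, hN0, hN⟩ := h.exists_norm_conv_le
  have hm : m2 (biotSavart ω) = fun a => ∫ s : AddCircle (1 : ℝ), -(conv ω (s, a)).im := by
    funext a
    simp only [m2, h.biotSavart_snd]
  have hmeas : StronglyMeasurable (m2 (biotSavart ω)) := by
    rw [hm]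
    refine StronglyMeasurable.integral_prod_left
      (f := fun (s : AddCircle (1 : ℝ)) (a : ℝ) => -(conv ω (s, a)).im) ?_
    exact (Complex.measurable_im.comp h.stronglyMeasurable_conv.measurable).neg.stronglyMeasurable
  have hb : ∀ a, ‖m2 (biotSavart ω) a‖ ≤ N := by
    intro a
    rw [hm]
    have := norm_integral_le_of_norm_le_const (μ := (volume : Measure (AddCircle (1 : ℝ))))
      (f := fun s : AddCircle (1 : ℝ) => -(conv ω (s, a)).im) (C := N)
      (Eventually.of_forall fun s => by
        rw [norm_neg]
        exact (Complex.abs_im_le_norm _).trans (hN _))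
    simpa [volume_real_univ_circle] using this
  have hloc : LocallyIntegrable (m2 (biotSavart ω)) := by
    refine (locallyIntegrable_const N).mono hmeas.aestronglyMeasurable
      (Eventually.of_forall fun a => ?_)
    rw [Real.norm_of_nonneg hN0]
    exact hb a
  refine ae_eq_zero_of_integral_contDiff_smul_eq_zero hloc fun ψ hψ hs => ?_
  have hz := integral_conv_mul_height_im h hψ.continuous hs
  obtain ⟨P, hP⟩ := hs.exists_bound_of_continuous hψ.continuous
  obtain ⟨R', hR'⟩ := hs.isCompact.isBounded.exists_norm_le
  have hi : Integrable fun x : Strip => conv ω x * ψ x.2 := by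
    refine integrable_of_height (N := N * P) (R := R')
      (h.stronglyMeasurable_conv.aestronglyMeasurable.mul
        (by have := hψ.continuous; fun_prop :
          Continuous fun x : Strip => (ψ x.2 : ℂ)).aestronglyMeasurable)
      (Eventually.of_forall fun x => ?_) (Eventually.of_forall fun x hx => ?_)
    · rw [norm_mul, Complex.norm_real]
      exact mul_le_mul (hN x) (hP _) (norm_nonneg _) hN0
    · have : ψ x.2 = 0 := by
        by_contra hne
        exact absurd (hR' _ (subset_tsupport ψ hne)) (not_le.2 hx)
      simp [this]
  have hi2 : Integrable fun x : Strip => (conv ω x * ψ x.2).im := Complex.imCLM.integrable_comp hi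
  have e1 : (∫ x : Strip, conv ω x * ψ x.2).im = ∫ x : Strip, (conv ω x * ψ x.2).im :=
    (Complex.imCLM.integral_comp_comm hi).symm
  rw [hz, Measure.volume_eq_prod,
    integral_prod_symm _ (by simpa [Measure.volume_eq_prod] using hi2)] at e1
  rw [← neg_eq_zero, ← integral_neg, e1]
  congr 1
  funext a
  rw [hm]
  simp only [Complex.im_mul_ofReal, integral_mul_const, integral_neg, smul_eq_mul]
  ring

end BoundedOn

end Strip

namespace Strip

/-! ### Weak derivatives on the line -/

/-- The primitive starting at -∞ vanishes below the support of ψ, and above it equals the total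
integral, which is zero. -/
theorem exists_primitive_of_integral_eq_zero {ψ : ℝ → ℝ} (hψ : ContDiff ℝ ((⊤ : ℕ∞) : WithTop ℕ∞) ψ)
    (hs : HasCompactSupport ψ) (h0 : ∫ t, ψ t = 0) :
    ∃ χ : ℝ → ℝ, ContDiff ℝ ((⊤ : ℕ∞) : WithTop ℕ∞) χ ∧ HasCompactSupport χ ∧ deriv χ = ψ := by
  obtain ⟨R, hR⟩ := hs.isCompact.isBounded.exists_norm_le
  have hz : ∀ t : ℝ, R < |t| → ψ t = 0 := by
    intro t ht
    by_contra hne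
    exact absurd (hR t (subset_tsupport ψ hne)) (not_le.2 ht)
  have hi : Integrable ψ := hψ.continuous.integrable_of_hasCompactSupport hs
  have hd : ∀ y, HasDerivAt (fun y => ∫ t in Set.Iic y, ψ t) (ψ y) y := by
    intro y
    have e : (fun y => ∫ t in Set.Iic y, ψ t) =
        fun y => (∫ t in Set.Iic 0, ψ t) + ∫ t in (0 : ℝ)..y, ψ t := by
      funext y
      have := intervalIntegral.integral_Iic_sub_Iic (a := 0) (b := y) (f := ψ) (μ := volume)
        hi.integrableOn hi.integrableOn
      rw [← this]
      ring
    rw [e]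
    exact (intervalIntegral.integral_hasDerivAt_right (hψ.continuous.intervalIntegrable _ _)
      (hψ.continuous.stronglyMeasurableAtFilter _ _) hψ.continuous.continuousAt).const_add _
  have hderiv : deriv (fun y => ∫ t in Set.Iic y, ψ t) = ψ := funext fun y => (hd y).deriv
  refine ⟨_, ?_, ?_, hderiv⟩
  · rw [contDiff_infty_iff_deriv, hderiv]
    exact ⟨fun y => (hd y).differentiableAt, hψ⟩
  · refine HasCompactSupport.intro (isCompact_Icc (a := -R) (b := R)) fun y hy => ?_
    rw [Set.mem_Icc, not_and_or, not_le, not_le] at hy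
    rcases hy with hy | hy
    · refine setIntegral_eq_zero_of_forall_eq_zero fun t ht => hz t ?_
      have ht : t ≤ y := ht
      rw [lt_abs]
      right
      linarith
    · rw [setIntegral_eq_integral_of_forall_compl_eq_zero, h0]
      intro t ht
      have ht : y < t := not_le.1 ht
      exact hz t (lt_abs.2 (Or.inl (by linarith)))

/-- The lemma of du Bois-Reymond. -/
theorem ae_eq_const_of_integral_deriv_smul_eq_zero {G : ℝ → ℂ} (hG : LocallyIntegrable G)
    (h : ∀ χ : ℝ → ℝ, ContDiff ℝ ((⊤ : ℕ∞) : WithTop ℕ∞) χ → HasCompactSupport χ →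
      ∫ y, deriv χ y • G y = 0) : ∃ c : ℂ, ∀ᵐ y, G y = c := by
  let b : ContDiffBump (0 : ℝ) := default
  set η : ℝ → ℝ := b.normed volume with hη
  have hηc : ContDiff ℝ ((⊤ : ℕ∞) : WithTop ℕ∞) η := b.contDiff_normed
  have hηs : HasCompactSupport η := b.hasCompactSupport_normed
  have hη1 : ∫ y, η y = 1 := b.integral_normed
  set c : ℂ := ∫ y, η y • G y with hc
  have hGi : ∀ ψ : ℝ → ℝ, Continuous ψ → HasCompactSupport ψ → Integrable fun y => ψ y • G y :=
    fun ψ h1 h2 => hG.integrable_smul_left_of_hasCompactSupport h1 h2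
  have key := ae_eq_zero_of_integral_contDiff_smul_eq_zero
    (hG.sub (locallyIntegrable_const c)) fun ψ hψ hs => ?_
  · refine ⟨c, ?_⟩
    filter_upwards [key] with y hy
    exact sub_eq_zero.1 hy
  · have hψi : Integrable ψ := hψ.continuous.integrable_of_hasCompactSupport hs
    have hηi : Integrable η := hηc.continuous.integrable_of_hasCompactSupport hηs
    set m := ∫ y, ψ y with hm
    have hms : HasCompactSupport fun y => m * η y := hηs.mul_left (f := fun _ => m)
    -- Subtracting m η, with η of integral 1, makes the mean of ψ zero; the hypothesis then gives ∫
    -- ψ G = m c.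
    obtain ⟨χ, hχ, hχs, hχd⟩ := exists_primitive_of_integral_eq_zero
      (ψ := fun y => ψ y - m * η y) (hψ.sub (contDiff_const.mul hηc))
      (hs.sub hms) (by
        rw [integral_sub hψi (hηi.const_mul m), integral_const_mul, hη1, ← hm]
        ring)
    have h1 := h χ hχ hχs
    rw [hχd] at h1
    have e1 : ∀ y, (ψ y - m * η y) • G y = ψ y • G y - m • (η y • G y) := by
      intro y
      rw [sub_smul, mul_smul]
    simp_rw [e1] at h1
    have hηG : Integrable fun y => m • (η y • G y) := (hGi η hηc.continuous hηs).smul m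
    rw [integral_sub (hGi ψ hψ.continuous hs) hηG, integral_smul, ← hc] at h1
    have e2 : ∀ y, ψ y • (G y - c) = ψ y • G y - ψ y • c :=
      fun y => smul_sub _ _ _
    change ∫ y, ψ y • (G y - c) = 0
    simp_rw [e2]
    rw [integral_sub (hGi ψ hψ.continuous hs) (hψi.smul_const c), integral_smul_const, ← hm]
    exact h1

/-- A bounded weak solution of `F' = -l F` on the line is constant, and zero if `l ≠ 0`. -/
theorem ae_eq_const_of_weak_linear_ode {F : ℝ → ℂ} {N l : ℝ} (hF : AEStronglyMeasurable F volume)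
    (hN : ∀ᵐ y, ‖F y‖ ≤ N)
    (h : ∀ ψ : ℝ → ℝ, ContDiff ℝ ((⊤ : ℕ∞) : WithTop ℕ∞) ψ → HasCompactSupport ψ →
      ∫ y, (deriv ψ y - l * ψ y) • F y = 0) :
    ∃ c : ℂ, (∀ᵐ y, F y = c) ∧ (l ≠ 0 → c = 0) := by
  have hexp : ContDiff ℝ ((⊤ : ℕ∞) : WithTop ℕ∞) fun y : ℝ => Real.exp (l * y) := by fun_prop
  have hFl : LocallyIntegrable F := by
    refine (locallyIntegrable_const N).mono hF ?_
    filter_upwards [hN] with y hy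
    exact hy.trans (le_abs_self N)
  -- Integrating factor: for ψ = exp(ly) χ one has ψ' - lψ = exp(ly) χ', so exp(ly) F has zero weak
  -- derivative.
  obtain ⟨c, hc⟩ := ae_eq_const_of_integral_deriv_smul_eq_zero
    (G := fun y => Real.exp (l * y) • F y) (hFl.continuous_smul hexp.continuous)
    fun χ hχ hχs => by
      rw [← h (fun y => Real.exp (l * y) * χ y) (hexp.mul hχ) hχs.mul_left]
      congr 1
      funext y
      have h1 : HasDerivAt (fun y => Real.exp (l * y)) (Real.exp (l * y) * l) y := by
        have := ((hasDerivAt_id y).const_mul l).exp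
        simpa using this
      have h2 := (hχ.differentiable (by simp) y).hasDerivAt
      have h3 : deriv (fun y => Real.exp (l * y) * χ y) y =
          Real.exp (l * y) * l * χ y + Real.exp (l * y) * deriv χ y := (h1.mul h2).deriv
      rw [h3, smul_smul]
      congr 1
      ring
  rcases eq_or_ne l 0 with rfl | hl
  · refine ⟨c, ?_, fun h => absurd rfl h⟩
    filter_upwards [hc] with y hy
    simpa using hy
  · have hc0 : c = 0 := by
      by_contra hne
      have hcpos : 0 < ‖c‖ := norm_pos_iff.2 hne
      have hcont : Continuous fun y : ℝ => N * Real.exp (l * y) := by fun_prop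
      have hopen : IsOpen {y : ℝ | N * Real.exp (l * y) < ‖c‖} :=
        isOpen_lt hcont continuous_const
      have hnull : volume {y : ℝ | N * Real.exp (l * y) < ‖c‖} = 0 := by
        have : ∀ᵐ y : ℝ, ¬ N * Real.exp (l * y) < ‖c‖ := by
          filter_upwards [hc, hN] with y h1 h2
          rw [not_lt, ← h1, norm_smul, Real.norm_of_nonneg (Real.exp_pos _).le, mul_comm]
          exact mul_le_mul_of_nonneg_right h2 (Real.exp_pos _).le
        simpa [ae_iff] using this
      have hempty := hopen.measure_eq_zero_iff volume |>.1 hnull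
      -- From ‖c‖ ≤ N exp(ly) almost everywhere, the open set of violations is null, hence empty.
      -- Yet it contains the point where exp(ly) = ‖c‖/(|N| + 1).
      have hy : (l⁻¹ * Real.log (‖c‖ / (|N| + 1))) ∈ {y : ℝ | N * Real.exp (l * y) < ‖c‖} := by
        have hp : 0 < |N| + 1 := by positivity
        rw [Set.mem_ofPred_eq, ← mul_assoc, mul_inv_cancel₀ hl, one_mul,
          Real.exp_log (by positivity), mul_div_assoc', div_lt_iff₀ hp]
        nlinarith [le_abs_self N]
      rw [hempty] at hy
      exact hy
    refine ⟨0, ?_, fun _ => rfl⟩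
    filter_upwards [hc] with y hy
    rw [hc0, smul_eq_zero] at hy
    exact hy.resolve_left (Real.exp_pos _).ne'

/-! ### Fourier series on the circle -/

theorem volume_circle_eq_haar :
    (volume : Measure (AddCircle (1 : ℝ))) = AddCircle.haarAddCircle := by
  rw [AddCircle.volume_eq_smul_haarAddCircle, ENNReal.ofReal_one, one_smul]

/-- Translation by 1/(2k) changes the sign of the integrand but not the integral. -/
theorem integral_fourier {k : ℤ} (hk : k ≠ 0) :
    ∫ s : AddCircle (1 : ℝ), fourier k s = 0 := by
  have h := integral_add_right_eq_self (μ := (volume : Measure (AddCircle (1 : ℝ))))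
    (fun s => fourier k s) (((1 : ℝ) / 2 / k : ℝ) : AddCircle (1 : ℝ))
  have e : ∀ s : AddCircle (1 : ℝ),
      fourier k (s + (((1 : ℝ) / 2 / k : ℝ) : AddCircle (1 : ℝ))) = -fourier k s :=
    fun s => fourier_add_half_inv_index hk one_pos s
  simp_rw [e] at h
  rw [integral_neg] at h
  exact self_eq_neg.1 h.symm

/-- A bounded function on the circle lies in L², where the exponentials form a Hilbert basis. -/
theorem ae_eq_zero_of_fourier {g : AddCircle (1 : ℝ) → ℂ} {N : ℝ}
    (hg : AEStronglyMeasurable g volume) (hN : ∀ᵐ s, ‖g s‖ ≤ N)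
    (h : ∀ k : ℤ, ∫ s, fourier (-k) s * g s = 0) : ∀ᵐ s, g s = 0 := by
  rw [volume_circle_eq_haar] at *
  have hL : MemLp g 2 AddCircle.haarAddCircle := MemLp.of_bound hg N hN
  have h0 : hL.toLp g = 0 := by
    apply fourierBasis.repr.injective
    rw [map_zero]
    ext k
    rw [fourierBasis_repr, fourierCoeff_congr_ae hL.coeFn_toLp, fourierCoeff]
    simpa using h k
  filter_upwards [hL.coeFn_toLp, Lp.eq_zero_iff_ae_eq_zero.1 h0] with s h1 h2
  rw [← h1, h2, Pi.zero_apply]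

/-! ### Liouville's theorem on the strip -/

/-- A separated function whose first factor lives on the circle. -/
theorem isTest_separated {k : ℤ} {L : ℂ →L[ℝ] ℝ} {ψ : ℝ → ℝ}
    (hψ : ContDiff ℝ ((⊤ : ℕ∞) : WithTop ℕ∞) ψ) (hs : HasCompactSupport ψ) :
    IsTest fun x : Strip => L (fourier k x.1) * ψ x.2 := by
  refine ⟨?_, ?_⟩
  · simp only [fourier_coe_apply]
    refine ContDiff.mul (L.contDiff.comp ?_) (hψ.comp contDiff_snd)
    have : ContDiff ℝ ((⊤ : ℕ∞) : WithTop ℕ∞) fun p : ℝ × ℝ => (p.1 : ℂ) :=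
      Complex.ofRealCLM.contDiff.comp contDiff_fst
    fun_prop
  · refine HasCompactSupport.intro (K := Set.univ ×ˢ tsupport ψ)
      (isCompact_univ.prod hs.isCompact) fun x hx => ?_
    have : ψ x.2 = 0 := by
      by_contra hne
      exact hx ⟨Set.mem_univ _, subset_tsupport ψ hne⟩
    rw [this, mul_zero]

theorem dbar_separated (k : ℤ) (L : ℂ →L[ℝ] ℝ) {ψ : ℝ → ℝ} (hψ : Differentiable ℝ ψ) (x : Strip) :
    dbar (fun x : Strip => L (fourier k x.1) * ψ x.2) x =
      L (2 * Real.pi * Complex.I * k * fourier k x.1) * ψ x.2 +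
        L (fourier k x.1) * deriv ψ x.2 * Complex.I := by
  obtain ⟨s, -, hs⟩ := exists_proj x
  have h1 : partialOne (fun x : Strip => L (fourier k x.1) * ψ x.2) x =
      L (2 * Real.pi * Complex.I * k * fourier k x.1) * ψ x.2 := by
    have hd := hasDerivAt_fourier (1 : ℝ) k s
    have hx : x.1 = (s : AddCircle (1 : ℝ)) := by rw [← hs]; rfl
    have hl : HasDerivAt (fun t : ℝ => s + t) 1 0 := (hasDerivAt_id (0 : ℝ)).const_add s
    have h3 := HasDerivAt.scomp_of_eq (0 : ℝ) hd hl (by simp)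
    have h4 := (L.hasFDerivAt.comp_hasDerivAt (0 : ℝ) h3).mul_const (ψ x.2)
    refine Eq.trans ?_ (h4.deriv.trans ?_)
    · simp only [partialOne, Function.comp_def, AddCircle.coe_add, hx]
    · simp [hx]
  have h2 : partialTwo (fun x : Strip => L (fourier k x.1) * ψ x.2) x =
      L (fourier k x.1) * deriv ψ x.2 := by
    have hl : HasDerivAt (fun t : ℝ => x.2 + t) 1 0 := (hasDerivAt_id (0 : ℝ)).const_add x.2
    have h3 := HasDerivAt.comp_of_eq (0 : ℝ) (hψ x.2).hasDerivAt hl (by simp)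
    have h4 := h3.const_mul (L (fourier k x.1))
    rw [mul_one] at h4
    exact h4.deriv
  rw [dbar, h1, h2]
  push_cast
  ring

/-- A bounded field without divergence and curl is constant. -/
theorem ae_eq_const_of_integral_mul_dbar_eq_zero {f : Strip → ℂ} {N : ℝ}
    (hf : AEStronglyMeasurable f volume) (hN : ∀ᵐ x, ‖f x‖ ≤ N)
    (h : ∀ φ : Strip → ℝ, IsTest φ → ∫ x, f x * dbar φ x = 0) : ∃ c : ℂ, ∀ᵐ x, f x = c := by
  set F : ℤ → ℝ → ℂ := fun k y => ∫ s : AddCircle (1 : ℝ), fourier (-k) s * f (s, y) with hFdef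
  have hfswap : AEStronglyMeasurable (fun p : ℝ × AddCircle (1 : ℝ) => f (p.2, p.1))
      (volume.prod volume) := hf.prod_swap
  have hNswap : ∀ᵐ y : ℝ, ∀ᵐ s : AddCircle (1 : ℝ), ‖f (s, y)‖ ≤ N :=
    Measure.ae_ae_of_ae_prod (p := fun p : ℝ × AddCircle (1 : ℝ) => ‖f (p.2, p.1)‖ ≤ N)
      (Measure.measurePreserving_swap.quasiMeasurePreserving.ae hN)
  have hfourier : ∀ (k : ℤ) (s : AddCircle (1 : ℝ)), ‖fourier k s‖ = 1 := fun k s =>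
    Circle.norm_coe _
  have hFm : ∀ k, AEStronglyMeasurable (F k) volume := by
    intro k
    have : AEStronglyMeasurable
        (fun p : ℝ × AddCircle (1 : ℝ) => fourier (-k) p.2 * f (p.2, p.1))
        (volume.prod volume) :=
      ((fourier (-k)).continuous.comp continuous_snd).aestronglyMeasurable.mul hfswap
    exact this.integral_prod_right'
  have hFb : ∀ k, ∀ᵐ y, ‖F k y‖ ≤ N := by
    intro k
    filter_upwards [hNswap] with y hy
    have := norm_integral_le_of_norm_le_const (μ := (volume : Measure (AddCircle (1 : ℝ))))
      (f := fun s => fourier (-k) s * f (s, y)) (C := N) (by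
        filter_upwards [hy] with s hs
        rwa [norm_mul, hfourier, one_mul])
    rwa [volume_real_univ_circle, mul_one] at this
  -- The k-th coefficient is a bounded weak solution of F' = -2πk F, hence constant, and zero unless
  -- k = 0.
  have hFode : ∀ k : ℤ, ∃ c : ℂ, (∀ᵐ y, F k y = c) ∧ (2 * Real.pi * k ≠ 0 → c = 0) := by
    intro k
    refine ae_eq_const_of_weak_linear_ode (hFm k) (hFb k) fun ψ hψ hs => ?_
    have hψd : Differentiable ℝ ψ := hψ.differentiable (by simp)
    have hψ' : Continuous (deriv ψ) := hψ.continuous_deriv (by simp)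
    set τ : ℝ → ℝ := fun y => deriv ψ y - 2 * Real.pi * k * ψ y with hτ
    have hτc : Continuous τ := hψ'.sub (continuous_const.mul hψ.continuous)
    have hτs : HasCompactSupport τ := hs.deriv.sub (hs.mul_left (f := fun _ => 2 * Real.pi * k))
    obtain ⟨P, hP⟩ := hτs.exists_bound_of_continuous hτc
    obtain ⟨R, hR⟩ := hτs.isCompact.isBounded.exists_norm_le
    have t1 := isTest_separated (k := -k) (L := Complex.reCLM) hψ hs
    have t2 := isTest_separated (k := -k) (L := Complex.imCLM) hψ hs
    have hint : ∀ φ : Strip → ℝ, IsTest φ → Integrable fun x => f x * dbar φ x := by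
      intro φ hφ
      obtain ⟨P, R, hP, hR⟩ := hφ.exists_bound_dbar
      refine integrable_of_height (N := N * P) (R := R)
        (hf.mul hφ.continuous_dbar.aestronglyMeasurable) ?_
        (Eventually.of_forall fun x hx => by rw [hR x hx, mul_zero])
      filter_upwards [hN] with x hx
      rw [norm_mul]
      exact mul_le_mul hx (hP x) (norm_nonneg _) ((norm_nonneg _).trans hx)
    -- Test functions are real, so the complex test function exp(-2πikx₁) ψ(x₂) is assembled from
    -- its real and imaginary parts. Applying ∂₁ + i∂₂ to it gives i(ψ' - 2πkψ) exp(-2πikx₁).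
    have e : ∀ x : Strip, f x * dbar (fun x => Complex.reCLM (fourier (-k) x.1) * ψ x.2) x +
        Complex.I * (f x * dbar (fun x => Complex.imCLM (fourier (-k) x.1) * ψ x.2) x) =
        Complex.I * (τ x.2 • (fourier (-k) x.1 * f x)) := by
      intro x
      rw [dbar_separated _ _ hψd, dbar_separated _ _ hψd]
      have hz := Complex.re_add_im (fourier (-k) x.1)
      have hw := Complex.re_add_im (2 * Real.pi * Complex.I * ((-k : ℤ) : ℂ) * fourier (-k) x.1)
      simp only [Complex.reCLM_apply, Complex.imCLM_apply, Complex.real_smul, hτ]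
      push_cast at hw ⊢
      linear_combination f x * ψ x.2 * hw + Complex.I * f x * ((deriv ψ x.2 : ℝ) : ℂ) * hz
    have hsum := integral_add (hint _ t1) ((hint _ t2).const_mul Complex.I)
    rw [integral_const_mul, h _ t1, h _ t2, mul_zero, add_zero] at hsum
    simp_rw [e] at hsum
    rw [integral_const_mul, mul_eq_zero] at hsum
    have hz := hsum.resolve_left Complex.I_ne_zero
    have hi : Integrable fun x : Strip => τ x.2 • (fourier (-k) x.1 * f x) := by
      refine integrable_of_height (N := P * N) (R := R)
        ((hτc.comp continuous_snd).aestronglyMeasurable.smul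
          (((fourier (-k)).continuous.comp continuous_fst).aestronglyMeasurable.mul hf)) ?_
        (Eventually.of_forall fun x hx => ?_)
      · filter_upwards [hN] with x hx
        rw [norm_smul, norm_mul, hfourier, one_mul]
        exact mul_le_mul (hP _) hx (norm_nonneg _) ((norm_nonneg _).trans (hP 0))
      · have : τ x.2 = 0 := by
          by_contra hne
          exact absurd (hR _ (subset_tsupport τ hne)) (not_le.2 hx)
        rw [this, zero_smul]
    rw [Measure.volume_eq_prod, integral_prod_symm _ hi] at hz
    simp_rw [integral_smul] at hz
    exact hz
  choose c hc using hFode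
  have hall : ∀ᵐ y : ℝ, ∀ᵐ s : AddCircle (1 : ℝ), f (s, y) = c 0 := by
    have hcoef : ∀ᵐ y : ℝ, ∀ k, F k y = c k := ae_all_iff.2 fun k => (hc k).1
    have hslice : ∀ᵐ y : ℝ, AEStronglyMeasurable (fun s : AddCircle (1 : ℝ) => f (s, y)) volume :=
      hfswap.prodMk_left
    filter_upwards [hcoef, hslice, hNswap] with y h1 h2 h3
    have h4 := ae_eq_zero_of_fourier (g := fun s => f (s, y) - c 0) (N := N + ‖c 0‖)
      (h2.sub aestronglyMeasurable_const)
      (by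
        filter_upwards [h3] with s hs
        exact (norm_sub_le _ _).trans (by gcongr)) fun k => ?_
    · filter_upwards [h4] with s hs
      exact sub_eq_zero.1 hs
    · have i1 : Integrable fun s : AddCircle (1 : ℝ) => fourier (-k) s * f (s, y) :=
        Integrable.of_bound ((fourier (-k)).continuous.aestronglyMeasurable.mul h2) N (by
          filter_upwards [h3] with s hs
          rwa [norm_mul, hfourier, one_mul])
      have i2 : Integrable fun s : AddCircle (1 : ℝ) => fourier (-k) s * c 0 :=
        Integrable.of_bound ((fourier (-k)).continuous.mul continuous_const).aestronglyMeasurable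
          ‖c 0‖ (Eventually.of_forall fun s => by rw [norm_mul, hfourier, one_mul])
      simp_rw [mul_sub]
      rw [integral_sub i1 i2, integral_mul_const]
      have e1 : ∫ s : AddCircle (1 : ℝ), fourier (-k) s * f (s, y) = c k := h1 k
      rw [e1]
      rcases eq_or_ne k 0 with rfl | hk
      · simp [volume_real_univ_circle]
      · rw [integral_fourier (neg_ne_zero.2 hk), (hc k).2 (by
          have := Real.pi_ne_zero
          positivity), zero_mul, sub_zero]
  refine ⟨c 0, ?_⟩
  have hmeas : AEStronglyMeasurable (fun p : ℝ × AddCircle (1 : ℝ) => f (p.2, p.1) - c 0)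
    (volume.prod volume) := hfswap.sub aestronglyMeasurable_const
  have h0 : ∀ᵐ p : ℝ × AddCircle (1 : ℝ) ∂(volume.prod volume), f (p.2, p.1) = c 0 := by
    have h1 : ∀ᵐ y : ℝ, ∀ᵐ s : AddCircle (1 : ℝ), ‖f (s, y) - c 0‖ₑ = 0 := by
      filter_upwards [hall] with y hy
      filter_upwards [hy] with s hs
      simp [hs]
    -- The passage from almost every line to almost every point goes through Tonelli for the norm of
    -- f - c, which is a.e. measurable.
    have h2 : ∫⁻ p : ℝ × AddCircle (1 : ℝ), ‖f (p.2, p.1) - c 0‖ₑ ∂(volume.prod volume) = 0 := by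
      rw [lintegral_prod _ hmeas.enorm]
      refine lintegral_eq_zero_of_ae_eq_zero ?_
      filter_upwards [h1] with y hy
      exact lintegral_eq_zero_of_ae_eq_zero hy
    rw [lintegral_eq_zero_iff' hmeas.enorm] at h2
    filter_upwards [h2] with p hp
    exact sub_eq_zero.1 (enorm_eq_zero.1 hp)
  exact Measure.measurePreserving_swap.quasiMeasurePreserving.ae
    (f := (Prod.swap : AddCircle (1 : ℝ) × ℝ → ℝ × AddCircle (1 : ℝ))) h0

end Strip

/-! ### The div-curl system, the mean conditions and the conclusion -/

namespace Strip

theorem integrable_mul_dbar {f : Strip → ℂ} (hf : MemLp f ∞ volume) {φ : Strip → ℝ}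
    (hφ : IsTest φ) : Integrable fun x => f x * dbar φ x := by
  obtain ⟨N, hN⟩ := exists_ae_norm_le_of_memLp_top hf
  obtain ⟨P, R, hP, hR⟩ := hφ.exists_bound_dbar
  refine integrable_of_height (N := N * P) (R := R)
    (hf.1.mul hφ.continuous_dbar.aestronglyMeasurable) ?_
    (Eventually.of_forall fun x hx => by rw [hR x hx, mul_zero])
  filter_upwards [hN] with x hx
  rw [norm_mul]
  exact mul_le_mul hx (hP x) (norm_nonneg _) ((norm_nonneg _).trans hx)

theorem memLp_toComplex {v : Strip → ℝ × ℝ} (hv : MemLp v ∞ volume) :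
    MemLp (fun x => toComplex (v x)) ∞ volume := toComplex.comp_memLp' hv

/-- Expanding (v¹ - iv²)(∂₁φ + i∂₂φ) puts the divergence pairing in the real part and the curl
pairing in the imaginary part. -/
theorem integral_mul_dbar_re {v : Strip → ℝ × ℝ} (hv : MemLp v ∞ volume) {φ : Strip → ℝ}
    (hφ : IsTest φ) : (∫ x, toComplex (v x) * dbar φ x).re =
      ∫ x, ((v x).1 * partialOne φ x + (v x).2 * partialTwo φ x) := by
  have e : (∫ x, toComplex (v x) * dbar φ x).re = ∫ x, (toComplex (v x) * dbar φ x).re :=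
    (Complex.reCLM.integral_comp_comm (integrable_mul_dbar (memLp_toComplex hv) hφ)).symm
  rw [e]
  congr 1
  funext x
  simp [dbar, Complex.mul_re]

theorem integral_mul_dbar_im {v : Strip → ℝ × ℝ} (hv : MemLp v ∞ volume) {φ : Strip → ℝ}
    (hφ : IsTest φ) : (∫ x, toComplex (v x) * dbar φ x).im =
      -∫ x, ((v x).2 * partialOne φ x - (v x).1 * partialTwo φ x) := by
  have e : (∫ x, toComplex (v x) * dbar φ x).im = ∫ x, (toComplex (v x) * dbar φ x).im :=
    (Complex.imCLM.integral_comp_comm (integrable_mul_dbar (memLp_toComplex hv) hφ)).symm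
  rw [e, ← integral_neg]
  congr 1
  funext x
  simp [dbar, Complex.mul_im]
  ring

theorem integral_ofReal_mul_ofReal (f g : Strip → ℝ) :
    ∫ x, (f x : ℂ) * g x = ((∫ x, f x * g x : ℝ) : ℂ) := by
  simp_rw [← Complex.ofReal_mul]
  exact integral_ofReal

/-- The div-curl system in complex form. -/
theorem integral_toComplex_mul_dbar {v : Strip → ℝ × ℝ} {ω : Strip → ℝ} (hv : MemLp v ∞ volume)
    (hd : IsDivFree v) (hc : HasCurl v ω) {φ : Strip → ℝ} (hφ : IsTest φ) :
    ∫ x, toComplex (v x) * dbar φ x = Complex.I * ∫ x, (ω x : ℂ) * φ x := by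
  rw [integral_ofReal_mul_ofReal]
  apply Complex.ext
  · rw [integral_mul_dbar_re hv hφ, hd.2 φ hφ]
    simp
  · rw [integral_mul_dbar_im hv hφ, hc.2.2 φ hφ]
    simp

namespace BoundedOn

variable {ω : Strip → ℝ} {M R : ℝ}

theorem memLp_biotSavart (h : BoundedOn ω M R) : MemLp (biotSavart ω) ∞ volume := by
  obtain ⟨N, -, hN⟩ := h.exists_norm_conv_le
  have hc : MemLp (conv ω) ∞ volume :=
    memLp_top_of_bound h.stronglyMeasurable_conv.aestronglyMeasurable N (Eventually.of_forall hN)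
  have e : biotSavart ω = fun x => ofComplex (conv ω x) := by
    funext x
    rw [← h.toComplex_biotSavart, ofComplex_toComplex]
  rw [e]
  exact ofComplex.comp_memLp' hc

theorem integral_biotSavart_mul_dbar (h : BoundedOn ω M R) {φ : Strip → ℝ} (hφ : IsTest φ) :
    ∫ x, toComplex (biotSavart ω x) * dbar φ x = Complex.I * ((∫ x, ω x * φ x : ℝ) : ℂ) := by
  simp_rw [h.toComplex_biotSavart]
  rw [h.integral_conv_mul_dbar hφ, integral_ofReal_mul_ofReal]

theorem isDivFree_biotSavart (h : BoundedOn ω M R) : IsDivFree (biotSavart ω) := by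
  refine ⟨h.memLp_biotSavart.locallyIntegrable le_top, fun φ hφ => ?_⟩
  rw [← integral_mul_dbar_re h.memLp_biotSavart hφ, h.integral_biotSavart_mul_dbar hφ]
  simp

theorem hasCurl_biotSavart (h : BoundedOn ω M R) : HasCurl (biotSavart ω) ω := by
  refine ⟨h.memLp_biotSavart.locallyIntegrable le_top, h.integrable.locallyIntegrable,
    fun φ hφ => ?_⟩
  rw [← integral_mul_dbar_im h.memLp_biotSavart hφ, h.integral_biotSavart_mul_dbar hφ]
  simp

/-- A bounded divergence free field with curl `ω` differs from `K_∞ * ω` by a constant. -/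
theorem exists_ae_eq_add (h : BoundedOn ω M R) {v : Strip → ℝ × ℝ} (hv : MemLp v ∞ volume)
    (hd : IsDivFree v) (hc : HasCurl v ω) :
    ∃ a : ℝ × ℝ, ∀ᵐ x, v x = biotSavart ω x + a := by
  have hdiff : MemLp (fun x => toComplex (v x) - toComplex (biotSavart ω x)) ∞ volume :=
    (memLp_toComplex hv).sub (memLp_toComplex h.memLp_biotSavart)
  obtain ⟨N, hN⟩ := exists_ae_norm_le_of_memLp_top hdiff
  obtain ⟨c, hc⟩ := ae_eq_const_of_integral_mul_dbar_eq_zero hdiff.1 hN fun φ hφ => by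
    simp_rw [sub_mul]
    rw [integral_sub (integrable_mul_dbar (memLp_toComplex hv) hφ)
      (integrable_mul_dbar (memLp_toComplex h.memLp_biotSavart) hφ),
      integral_toComplex_mul_dbar hv hd hc hφ,
      integral_toComplex_mul_dbar h.memLp_biotSavart h.isDivFree_biotSavart
        h.hasCurl_biotSavart hφ, sub_self]
  refine ⟨ofComplex c, ?_⟩
  filter_upwards [hc] with x hx
  apply toComplex_injective
  rw [map_add, toComplex_ofComplex, ← hx]
  ring

theorem integrable_biotSavart_line (h : BoundedOn ω M R) (a : ℝ) :
    Integrable fun s : AddCircle (1 : ℝ) => biotSavart ω (s, a) := by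
  refine (ofComplex.integrable_comp (h.integrable_conv_line a)).congr
    (Eventually.of_forall fun s => ?_)
  simp only
  rw [← h.toComplex_biotSavart, ofComplex_toComplex]

theorem ae_means_eq (h : BoundedOn ω M R) {v : Strip → ℝ × ℝ} {a : ℝ × ℝ}
    (hv : ∀ᵐ x, v x = biotSavart ω x + a) :
    ∀ᵐ y : ℝ, m1 v y = m1 (biotSavart ω) y + a.1 ∧ m2 v y = m2 (biotSavart ω) y + a.2 := by
  have hswap : ∀ᵐ y : ℝ, ∀ᵐ s : AddCircle (1 : ℝ), v (s, y) = biotSavart ω (s, y) + a :=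
    Measure.ae_ae_of_ae_prod
      (p := fun p : ℝ × AddCircle (1 : ℝ) => v (p.2, p.1) = biotSavart ω (p.2, p.1) + a)
      (Measure.measurePreserving_swap.quasiMeasurePreserving.ae hv)
  filter_upwards [hswap] with y hy
  have i1 : Integrable fun s : AddCircle (1 : ℝ) => (biotSavart ω (s, y)).1 :=
    (h.integrable_biotSavart_line y).fst
  have i2 : Integrable fun s : AddCircle (1 : ℝ) => (biotSavart ω (s, y)).2 :=
    (h.integrable_biotSavart_line y).snd
  constructor
  · have e : m1 v y = ∫ s : AddCircle (1 : ℝ), ((biotSavart ω (s, y)).1 + a.1) := by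
      refine integral_congr_ae ?_
      filter_upwards [hy] with s hs
      rw [hs, Prod.fst_add]
    rw [e, integral_add i1 (integrable_const _), integral_const, volume_real_univ_circle, one_smul,
      m1]
  · have e : m2 v y = ∫ s : AddCircle (1 : ℝ), ((biotSavart ω (s, y)).2 + a.2) := by
      refine integral_congr_ae ?_
      filter_upwards [hy] with s hs
      rw [hs, Prod.snd_add]
    rw [e, integral_add i2 (integrable_const _), integral_const, volume_real_univ_circle, one_smul,
      m2]

/-- The limits at the two ends carry opposite multiples of ∫ω, so their sum is 2a¹; together with m₂
= a² this determines a. -/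
theorem means_of_ae_eq_add (h : BoundedOn ω M R) {v : Strip → ℝ × ℝ} {a : ℝ × ℝ}
    (hv : ∀ᵐ x, v x = biotSavart ω x + a) :
    HasM2 v a.2 ∧ HasM1Bot v (1 / 2 * (∫ y, ω y) + a.1) ∧
      HasM1Top v (-(1 / 2) * (∫ y, ω y) + a.1) := by
  have hm := h.ae_means_eq hv
  have hm1 : ∀ᵐ y : ℝ, m1 (biotSavart ω) y + a.1 = m1 v y := hm.mono fun y hy => hy.1.symm
  refine ⟨?_, ?_, ?_⟩
  · filter_upwards [hm, h.hasM2] with y h1 h2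
    rw [h1.2, h2, zero_add]
  · exact (h.hasM1Bot.add_const a.1).congr' (hm1.filter_mono inf_le_right)
  · exact (h.hasM1Top.add_const a.1).congr' (hm1.filter_mono inf_le_right)

end BoundedOn

/-- A half-line is not null, so the filter is proper; this is what makes m₁[v](∞) unique as a limit.
-/
instance neBot_atTop_inf_ae : (atTop ⊓ ae (volume : Measure ℝ)).NeBot := by
  rw [inf_neBot_iff]
  intro s hs t ht
  obtain ⟨A, hA⟩ := mem_atTop_sets.1 hs
  by_contra hne
  have hsub : Set.Ici A ⊆ tᶜ := fun x hx hxt => hne ⟨x, hA x hx, hxt⟩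
  have := measure_mono_null hsub ht
  simp at this

instance neBot_atBot_inf_ae : (atBot ⊓ ae (volume : Measure ℝ)).NeBot := by
  rw [inf_neBot_iff]
  intro s hs t ht
  obtain ⟨A, hA⟩ := mem_atBot_sets.1 hs
  by_contra hne
  have hsub : Set.Iic A ⊆ tᶜ := fun x hx hxt => hne ⟨x, hA x hx, hxt⟩
  have := measure_mono_null hsub ht
  simp at this

end Strip

theorem lemmaL (ω : Strip → ℝ) (hω : Strip.MemLinftyC ω) :
    -- the convolution integral converges absolutely at every point
    (∀ x : Strip, Integrable (fun y : Strip => ω y • Strip.kernel (x - y)) volume) ∧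
    -- characterization of `v = K_∞ * ω`; the numbers `m₂`, `m₁(±∞)` exist
    (∀ v : Strip → ℝ × ℝ, Strip.MemS v → Strip.HasCurl v ω →
      ∃ m₂ mBot mTop : ℝ,
        Strip.HasM2 v m₂ ∧ Strip.HasM1Bot v mBot ∧ Strip.HasM1Top v mTop ∧
        (v =ᵐ[volume] Strip.biotSavart ω ↔ m₂ = 0 ∧ mBot + mTop = 0)) ∧
    -- `K_∞ * ω` is in `S(Π)`, has curl `ω` and satisfies the mean conditions
    (Strip.MemS (Strip.biotSavart ω) ∧ Strip.HasCurl (Strip.biotSavart ω) ω ∧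
      Strip.HasM2 (Strip.biotSavart ω) 0 ∧
      ∃ mBot mTop : ℝ, Strip.HasM1Bot (Strip.biotSavart ω) mBot ∧
        Strip.HasM1Top (Strip.biotSavart ω) mTop ∧ mBot + mTop = 0) ∧
    -- and it is the only such field
    (∀ v : Strip → ℝ × ℝ, Strip.MemS v → Strip.HasCurl v ω → Strip.HasM2 v 0 →
      (∃ mBot mTop : ℝ, Strip.HasM1Bot v mBot ∧ Strip.HasM1Top v mTop ∧ mBot + mTop = 0) →
      v =ᵐ[volume] Strip.biotSavart ω) := by
  obtain ⟨M, R, h⟩ := hω.exists_boundedOn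
  have hS : Strip.MemS (Strip.biotSavart ω) :=
    ⟨h.memLp_biotSavart, h.isDivFree_biotSavart, ω, hω.1, h.hasCurl_biotSavart⟩
  refine ⟨h.integrable_smul_kernel, fun v hv hc => ?_, ⟨hS, h.hasCurl_biotSavart, h.hasM2,
    _, _, h.hasM1Bot, h.hasM1Top, by ring⟩, fun v hv hc h2 ⟨mBot, mTop, hb, ht, hsum⟩ => ?_⟩
  · obtain ⟨a, ha⟩ := h.exists_ae_eq_add hv.bounded hv.divFree hc
    obtain ⟨h1, h2, h3⟩ := h.means_of_ae_eq_add ha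
    refine ⟨_, _, _, h1, h2, h3, fun heq => ?_, fun ⟨e2, e1⟩ => ?_⟩
    -- The strip is not null, so two properties holding almost everywhere hold together at some
    -- point.
    · obtain ⟨x, hx1, hx2⟩ := (heq.and ha).exists
      have ha0 : a = 0 := by
        rw [hx1] at hx2
        exact left_eq_add.1 hx2
      rw [ha0]
      exact ⟨rfl, by simp⟩
    · have ha0 : a = 0 := Prod.ext (by simp only [Prod.fst_zero]; linarith) e2
      filter_upwards [ha] with x hx
      rw [hx, ha0, add_zero]
  · obtain ⟨a, ha⟩ := h.exists_ae_eq_add hv.bounded hv.divFree hc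
    obtain ⟨k2, kb, kt⟩ := h.means_of_ae_eq_add ha
    obtain ⟨y, hy1, hy2⟩ := (k2.and h2).exists
    have e1 := tendsto_nhds_unique hb kb
    have e2 := tendsto_nhds_unique ht kt
    have ha0 : a = 0 := Prod.ext (by simp only [Prod.fst_zero]; linarith) (hy1.symm.trans hy2)
    filter_upwards [ha] with x hx
    rw [hx, ha0, add_zero]
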